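/- **Problem.** An instance of $1||\sum T_i$ consists of $n$ jobs with processing times $p_j\in\mathbb N$ and due dates $d_j\in\mathbb N$. A sequence of all jobs is processed on one machine without interruption from time $0$; job $j$ completes at time $C_j$ and has tardiness $T_j=\max\{C_j-d_j,0\}$. The problem is to find a sequence that minimizes $\sum_j T_j$. **Branching.** For a set $S$ of $m\ge 1$ jobs to be processed from time $t$, let $[1],\dots,[m]$ be its jobs in EDD order (nondecreasing $d$, ties by nondecreasing $p$), and let $\ell=[\kappa]$ be its longest job (ties by smallest due date). Position $i$ is *eligible* if $\kappa\le i\le m$; putting $\ell$ in position $i$ leaves the subproblem $B(i)=\{[1],\dots,[i]\}\setminus\{\ell\}$ from time $t$ before $\ell$, and the subproblem $A(i)=\{[i+1],\dots,[m]\}$ from time $C(i)=t+\sum_{r\le i}p_{[r]}$ after $\ell$. Position $i$ is *eliminated* if $i<m$ and $C(i)\ge d_{[i+1]}$, or if $C(i)<d_{[r]}+p_{[r]}$ for some $r\in\{\kappa+1,\dots,i\}$. Algorithm TTBR1 solves $(S,t)$ by solving $B(i)$ and $A(i)$ recursively for every eligible $i$ and returning the best sequence obtained. **Algorithm TTBM-L**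 with parameter $k\ge 2$. A node consists of a start time $t$, a fixed sequence $\pi$ started at $t$, a set $S=\{[1],\dots,[m]\}$ of jobs to be scheduled after $\pi$, and a list $L$, which is empty or contains replacements for the first $k-1$ children of the node. The first $k$ children are as follows. If $L$ is empty or $j=k$, the $j$-th child exists if $j$ is an eligible position of the longest job $\ell$ of $S$, and it has the fixed sequence $\pi\,\beta\,\ell$, where $\beta$ is the TTBR1 solution of $B(j)$ (started when $\pi$ ends); otherwise it is the $j$-th entry of $L$, which may be missing. In each case the jobs $[j+1],\dots,[m]$ remain. The node is solved, that is, a best sequence found for the jobs of $\pi$ and $S$ is returned, as follows. * If $m<k$: the node, and each node of $L$, is completed by TTBR1 on its remaining jobs, and the best result is returned. * If $m\ge k$ and the first child $P_1$ exists (left merging): for $j=1,\dots,k-1$, the $(j+1)$-st child of the node is merged with the $j$-th child of $P_1$ obtained by branching (both fix the same jobs); the one whose fixed sequence has the smaller total tardiness from $t$ is kept, or the existing one if only one exists. Then $P_1$ is solved recursively with the list of the $k-1$ merged nodes. If $P_1$ does not exist, each existing child $2,\dots,k$ is solved recursively with an empty list. * If $m\ge k$, moreover, for every eligible, not eliminated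 position $i\in\{k+1,\dots,m\}$ of $\ell$ in $S$, the subproblems $B(i)$ and $A(i)$ are solved recursively (nothing fixed, empty list) and their solutions are combined with $\pi$ and $\ell$. The best of all sequences found is returned. TTBM-L starts from the node with $t=0$, $\pi$ empty, $S$ the set of all jobs and $L$ empty. Time is the number of elementary operations on a unit-cost random access machine (arithmetic and comparisons of numbers, reading input data, list operations), and space is the largest number of memory cells simultaneously in use. **Proposition.** For every $k\ge 2$, TTBM-L returns an optimal sequence on every instance. There are numbers $\varepsilon_k\ge 0$ with $\varepsilon_k\to 0$ as $k\to\infty$ such that, for every fixed $k\ge 2$, TTBM-L with parameter $k$ runs in $O^*\big((2.247+\varepsilon_k)^n\big)$ time and polynomial space: there is a polynomial $q_k$ such that on every instance with $n$ jobs the running time is at most $q_k(n)\,(2.247+\varepsilon_k)^n$ and the space is at most $q_k(n)$. -/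

import Mathlib

namespace TotalTardiness

/-! ### The problem -/

/-- An instance with `n` jobs: processing times and due dates. -/
structure Data (n : ℕ) where
  p : Fin n → ℕ
  d : Fin n → ℕ

variable {n : ℕ}

/-- Total tardiness of the jobs of a sequence that is processed without interruption from time `t`.
The first job `j` completes at `t + p j`; truncated subtraction is `max (C - d) 0`. -/
def Data.tardiness (I : Data n) : ℕ → List (Fin n) → ℕ
  | _, [] => 0
  | t, j :: σ => (t + I.p j - I.d j) + I.tardiness (t + I.p j) σ

/-- `σ` is a sequence of all the jobs, each exactly once. -/
def IsSequence (σ : List (Fin n)) : Prop := σ.Nodup ∧ ∀ j, j ∈ σ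

/-- `σ` is an optimal solution: a sequence of all jobs of least total tardiness from time `0`. -/
def Data.IsOptimal (I : Data n) (σ : List (Fin n)) : Prop :=
  IsSequence σ ∧ ∀ τ, IsSequence τ → I.tardiness 0 σ ≤ I.tardiness 0 τ

/-! ### The cost model

Unit-cost random access machine with region (stack) allocation. A memory cell holds a constant
number of words: numbers, job names, pointers. The instance is read-only input with random
access. Every elementary operation takes one unit of time and writes one fresh cell; this also pays
for the stack space of a loop or of an auxiliary recursion. Cells are released only when a
procedure call returns: then everything written during the call is released, except that the
returned list is copied, at unit time per cell, into the memory of the caller. -/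

/-- A computation with its result and its cost. -/
structure Comp (α : Type) where
  val : α
  /-- number of elementary steps -/
  time : ℕ
  /-- number of cells written and not released at the end -/
  kept : ℕ
  /-- largest number of cells that are simultaneously in use -/
  peak : ℕ

instance : Monad Comp where
  pure a := ⟨a, 0, 0, 0⟩
  bind m f :=
    ⟨(f m.val).val, m.time + (f m.val).time, m.kept + (f m.val).kept,
      max m.peak (m.kept + (f m.val).peak)⟩

/-- One elementary operation, with result `a`. -/
def step {α : Type} (a : α) : Comp α := ⟨a, 1, 1, 1⟩

/-- A procedure call that returns a list: one cell for the frame, memory of the callee on top of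
that of the caller, and at the end only the copy of the result survives. -/
def call {α : Type} (m : Comp (List α)) : Comp (List α) :=
  ⟨m.val, 1 + m.time + m.val.length, m.val.length, 1 + m.peak + m.val.length⟩

/-! Elementary operations on numbers, jobs and lists. -/

def add (a b : ℕ) : Comp ℕ := step (a + b)
def sub (a b : ℕ) : Comp ℕ := step (a - b)
def lt (a b : ℕ) : Comp Bool := step (decide (a < b))
def le (a b : ℕ) : Comp Bool := step (decide (a ≤ b))
def eqJob (i j : Fin n) : Comp Bool := step (decide (i = j))
def procTime (I : Data n) (j : Fin n) : Comp ℕ := step (I.p j)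
def dueDate (I : Data n) (j : Fin n) : Comp ℕ := step (I.d j)
def cons {α : Type} (a : α) (l : List α) : Comp (List α) := step (a :: l)

/-- `for i = a, a + 1, ..., a + m - 1`, updating `b`. -/
def forLoop {β : Type} (body : ℕ → β → Comp β) : (a m : ℕ) → β → Comp β
  | _, 0, b => step b
  | a, m + 1, b => do
    let b' ← body a b
    let a' ← add a 1
    forLoop body a' m b'

/-! ### List routines -/

def length {α : Type} : List α → Comp ℕ
  | [] => step 0
  | _ :: l => do
    let m ← length l
    add m 1

def append {α : Type} : List α → List α → Comp (List α)
  | [], l' => step l'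
  | a :: l, l' => do
    let r ← append l l'
    cons a r

/-- The first `i` entries and the remaining ones. -/
def split {α : Type} : ℕ → List α → Comp (List α × List α)
  | 0, l => step ([], l)
  | _ + 1, [] => step ([], [])
  | i + 1, a :: l => do
    let r ← split i l
    let l₁ ← cons a r.1
    step (l₁, r.2)

/-- Remove job `j` from a list in which it occurs once. -/
def remove (j : Fin n) : List (Fin n) → Comp (List (Fin n))
  | [] => step []
  | a :: l => do
    let b ← eqJob a j
    if b then step l else do
      let r ← remove j l
      cons a r

/-- `t` plus the total processing time of a list of jobs. -/
def endTime (I : Data n) : ℕ → List (Fin n) → Comp ℕ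
  | t, [] => step t
  | t, j :: l => do
    let q ← procTime I j
    let t' ← add t q
    endTime I t' l

/-- Computes the total tardiness of a sequence started at time `t`. -/
def evalSeq (I : Data n) : ℕ → List (Fin n) → Comp ℕ
  | _, [] => step 0
  | t, j :: l => do
    let q ← procTime I j
    let c ← add t q
    let e ← dueDate I j
    let late ← sub c e
    let r ← evalSeq I c l
    add late r

/-- The better of two sequences of the same jobs, both started at time `t`. -/
def best (I : Data n) (t : ℕ) (σ τ : List (Fin n)) : Comp (List (Fin n)) := do
  let a ← evalSeq I t σ
  let b ← evalSeq I t τ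
  let c ← le a b
  if c then step σ else step τ

/-! ### EDD order and the longest job -/

/-- `i` comes strictly before `j` in the order of due dates, ties broken by processing times. -/
def eddBefore (I : Data n) (i j : Fin n) : Comp Bool := do
  let a ← dueDate I i
  let b ← dueDate I j
  let c ← lt a b
  if c then step true else do
    let c' ← lt b a
    if c' then step false else do
      let q ← procTime I i
      let r ← procTime I j
      lt q r

def eddInsert (I : Data n) (j : Fin n) : List (Fin n) → Comp (List (Fin n))
  | [] => cons j []
  | a :: l => do
    let b ← eddBefore I a j
    if b then do
      let r ← eddInsert I j l
      cons a r
    else do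
      let r ← cons a l
      cons j r

/-- Sorts a list of jobs in EDD order (earliest due date first). -/
def eddSort (I : Data n) : List (Fin n) → Comp (List (Fin n))
  | [] => step []
  | j :: l => do
    let r ← eddSort I l
    eddInsert I j r

/-- Scan with current best job `b` in position `κ`; the head of the list has position `i`. -/
def longestAux (I : Data n) : Fin n → ℕ → ℕ → List (Fin n) → Comp (Fin n × ℕ)
  | b, κ, _, [] => step (b, κ)
  | b, κ, i, a :: l => do
    let q ← procTime I b
    let r ← procTime I a
    let c ← lt q r
    let i' ← add i 1
    if c then longestAux I a i i' l else longestAux I b κ i' l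

/-- The longest job of an EDD-sorted list `a :: l`, and its position, counted from `1`.
Ties are broken in favour of the earliest due date, which is the first one in the list. -/
def longest (I : Data n) (a : Fin n) (l : List (Fin n)) : Comp (Fin n × ℕ) :=
  longestAux I a 1 2 l

/-! ### Branching

All job sets are kept as EDD-sorted lists `S = [1], [2], ..., [m]`. Let `[κ]` be the longest job `ℓ`
of `S`. Branching puts `ℓ` in a position `i ≥ κ`; the set before `ℓ` is `[1], ..., [i]` without
`ℓ`, and the set after `ℓ` is `[i+1], ..., [m]`. -/

/-- TTBR1: branch on every eligible position of the longest job. The first argument bounds the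
depth of the recursion; it is always called with a bound of at least the number of jobs. -/
def ttbr1 (I : Data n) : ℕ → List (Fin n) → ℕ → Comp (List (Fin n))
  | 0, S, _ => step S
  | _ + 1, [], _ => step []
  | depth + 1, a :: l, t => do
    let (ℓ, κ) ← longest I a l
    let m ← length (a :: l)
    let m' ← add m 1
    let count ← sub m' κ
    forLoop (fun i seqOpt => do
      let (front, A) ← split i (a :: l)
      let B ← remove ℓ front
      let c ← endTime I t front
      let left ← call (ttbr1 I depth B t)
      let right ← call (ttbr1 I depth A c)
      let tail ← cons ℓ right
      let seqCurrent ← append left tail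
      best I t seqOpt seqCurrent) κ count (a :: l)

/-- Is `c < d r + p r` for some job `r` of the list? -/
def someLate (I : Data n) (c : ℕ) : List (Fin n) → Comp Bool
  | [] => step false
  | r :: l => do
    let e ← dueDate I r
    let q ← procTime I r
    let s ← add e q
    let b ← lt c s
    if b then step true else someLate I c l

/-- The elimination test for position `i` of the longest job `[κ]`, where `front` is
`[1], ..., [i]`, `A` is `[i+1], ..., [m]` and `c` is the completion time of the longest job:
(a) `i < m` and `c ≥ d [i+1]`, or (b) `c < d [r] + p [r]` for some `r = κ+1, ..., i`. -/
def eliminated (I : Data n) (κ c : ℕ) (front A : List (Fin n)) : Comp Bool := do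
  let (_, mid) ← split κ front
  let late ← someLate I c mid
  match A with
  | [] => step late
  | a :: _ => do
    let e ← dueDate I a
    let b ← le e c
    if b then step true else step late

/-! ### Left merging

A node consists of a sequence `π` of fixed jobs, started at time `t`, and of the EDD-sorted list
`S` of jobs that remain to be scheduled after `π`. Its `j`-th child for `j ≤ k` fixes the jobs
`[1], ..., [j]` of `S` as well; so it is given by a sequence of the jobs of `π` and
`[1], ..., [j]`, and the remaining list is `S` without its first `j` entries. It is `none` if
the child does not exist. A node also carries the list of its first `k - 1` children if they
result from a merging; otherwise this list is empty. -/

/-- The `j`-th child of the node `(π, S)` by branching, the small subproblem before the longest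
job being solved by TTBR1; `none` if position `j` is not eligible. -/
def child (I : Data n) (k t : ℕ) (π S : List (Fin n)) (j : ℕ) :
    Comp (Option (List (Fin n))) :=
  match S with
  | [] => step none
  | a :: l => do
    let (ℓ, κ) ← longest I a l
    let b ← le κ j
    if b then do
      let (front, _) ← split j (a :: l)
      let B ← remove ℓ front
      let t' ← endTime I t π
      let left ← call (ttbr1 I k B t')
      let tail ← cons ℓ []
      let mid ← append left tail
      let r ← append π mid
      step (some r)
    else step none

/-- The children `j, j + 1, ..., j + m - 1` of `(π, S)` by branching. -/
def childrenFrom (I : Data n) (k t : ℕ) (π S : List (Fin n)) :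
    (j m : ℕ) → Comp (List (Option (List (Fin n))))
  | _, 0 => step []
  | j, m + 1 => do
    let c ← child I k t π S j
    let j' ← add j 1
    let r ← childrenFrom I k t π S j' m
    cons c r

/-- The first `k` children of a node with list `L` by the improved branching. -/
def firstChildren (I : Data n) (k t : ℕ) (π S : List (Fin n))
    (L : List (Option (List (Fin n)))) : Comp (List (Option (List (Fin n)))) :=
  match L with
  | [] => childrenFrom I k t π S 1 k
  | _ :: _ => do
    let r ← childrenFrom I k t π S k 1
    append L r

/-- The better one of two nodes with the same fixed job set. -/
def bestNode (I : Data n) (t : ℕ) :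
    Option (List (Fin n)) → Option (List (Fin n)) → Comp (Option (List (Fin n)))
  | none, y => step y
  | some σ, none => step (some σ)
  | some σ, some τ => do
    let r ← best I t σ τ
    step (some r)

/-- Merges two lists of nodes entry by entry. -/
def mergeNodes (I : Data n) (t : ℕ) :
    List (Option (List (Fin n))) → List (Option (List (Fin n))) →
      Comp (List (Option (List (Fin n))))
  | x :: X, y :: Y => do
    let z ← bestNode I t x y
    let Z ← mergeNodes I t X Y
    cons z Z
  | _, _ => step []

/-- LEFT_MERGE: given the first child `(π₁, S₁)` of a node and the children `2, ..., k` of that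
node, the latter are merged with the children `1, ..., k - 1` of `(π₁, S₁)`; the result is the
list of the first `k - 1` children with which `(π₁, S₁)` will be explored. -/
def leftMerge (I : Data n) (k t : ℕ) (π₁ S₁ : List (Fin n))
    (others : List (Option (List (Fin n)))) : Comp (List (Option (List (Fin n)))) := do
  let k' ← sub k 1
  let own ← childrenFrom I k t π₁ S₁ 1 k'
  mergeNodes I t others own

/-- Explores each existing node of a list with the procedure `solve` and returns the best solution
found. The nodes of the list are the children `j, j + 1, ...` of a node with remaining jobs `S`. -/
def explore (I : Data n) (t : ℕ) (solve : List (Fin n) → List (Fin n) → Comp (List (Fin n)))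
    (S : List (Fin n)) :
    ℕ → List (Option (List (Fin n))) → List (Fin n) → Comp (List (Fin n))
  | _, [], seqOpt => step seqOpt
  | j, none :: L, seqOpt => do
    let j' ← add j 1
    explore I t solve S j' L seqOpt
  | j, some π :: L, seqOpt => do
    let (_, rest) ← split j S
    let seqCurrent ← call (solve π rest)
    let seqOpt' ← best I t seqOpt seqCurrent
    let j' ← add j 1
    explore I t solve S j' L seqOpt'

/-- Completes the sequence `π`, started at time `t`, by TTBR1 on a list `S` of fewer than `k` jobs. -/
def completeSmall (I : Data n) (k t : ℕ) (π S : List (Fin n)) : Comp (List (Fin n)) := do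
  let t' ← endTime I t π
  let σ ← call (ttbr1 I k S t')
  append π σ

/-- TTBM-L on the node with fixed sequence `π` started at time `t`, remaining EDD-sorted list `S` and
list `L` of merged children: the best sequence found for the jobs of `π` and `S` together.
The first numeric argument bounds the depth of the recursion; it always exceeds the number of jobs
in `S`. -/
def ttbmlNode (I : Data n) (k : ℕ) :
    ℕ → ℕ → List (Fin n) → List (Fin n) → List (Option (List (Fin n))) → Comp (List (Fin n))
  | 0, _, π, S, _ => append π S
  | depth + 1, t, π, S, L => do
    let m ← length S
    let small ← lt m k
    if small then do
      -- fewer than `k` jobs: TTBR1, on the node itself and on its merged children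
      let seqOpt ← completeSmall I k t π S
      explore I t (completeSmall I k t) S 1 L seqOpt
    else do
      let seqInit ← append π S
      let children ← firstChildren I k t π S L
      -- positions `1, ..., k`: merged into the first child if that exists
      let seqOpt ← match children with
        | some π₁ :: others => do
          let (_, S₁) ← split 1 S
          let L₁ ← leftMerge I k t π₁ S₁ others
          let seqCurrent ← call (ttbmlNode I k depth t π₁ S₁ L₁)
          best I t seqInit seqCurrent
        | others => explore I t (fun π' S' => ttbmlNode I k depth t π' S' []) S 1 others seqInit
      -- positions `k + 1, ..., m`: branching as in TTBR1, with elimination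
      match S with
      | [] => step seqOpt
      | a :: l => do
        let (ℓ, κ) ← longest I a l
        let t' ← endTime I t π
        let first ← add k 1
        let count ← sub m k
        forLoop (fun i seqOpt => do
          let eligible ← le κ i
          if eligible then do
            let (front, A) ← split i (a :: l)
            let c ← endTime I t' front
            let e ← eliminated I κ c front A
            if e then step seqOpt else do
              let B ← remove ℓ front
              let left ← call (ttbmlNode I k depth t' [] B [])
              let right ← call (ttbmlNode I k depth c [] A [])
              let tail ← cons ℓ right
              let mid ← append left tail
              let seqCurrent ← append π mid
              best I t seqOpt seqCurrent
          else step seqOpt) first count seqOpt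

/-- Algorithm TTBM-L with parameter `k`. -/
def ttbml (I : Data n) (k : ℕ) : Comp (List (Fin n)) := do
  let S ← eddSort I (List.finRange n)
  ttbmlNode I k (n + 1) 0 [] S []

end TotalTardiness

namespace TotalTardiness

variable {n : ℕ} {α β : Type}

/-! ### A logic for results and costs -/

/-! Correctness rests on `Data.exists_decomposition`: any sequence of an EDD-sorted set is dominated
by one in which the longest job `ℓ` has an eligible, not eliminated position `i`, preceded exactly
by the other jobs among the first `i`. It follows from two exchange arguments. A job behind `ℓ` that
is due no later than `ℓ`, or by the completion of `ℓ`, is swapped with `ℓ`. A job that follows `ℓ`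
in EDD order but precedes it in the sequence is moved directly behind `ℓ` if it would start there
before its due date. Since `ℓ` then splits the EDD order at a threshold, the rest of the sequence
divides into the independent subproblems `B(i)` and `A(i)`.

Left merging is sound because two merged nodes fix the same jobs from the same start time. Every
completion therefore starts at the same time and has the same cost after either of them, and the
better prefix dominates. The invariant `NodeSolution` records that solving a node also beats all
completions of the nodes in its list, so solving the first child covers its merged siblings.

For the running time, a node with `m ≥ k` jobs causes one call of size `m - 1` (if the first child
is missing, calls of sizes from `m - 2` downwards, whose powers of `x ≥ 2` sum to at most `x ^ (m -
1)`), and calls of sizes `i - 1` and `m - i` for the surviving positions `i > k`. Of two adjacent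
eligible positions one is eliminated, so the sizes `i - 1` contribute at most `x ^ (m - 1) + x ^ (m
- 3) + ...`, which is below `x ^ (m + 1) / (x ^ 2 - 1)`. The sizes `m - i` contribute at most `x ^
(m - k) / (x - 1)`. Division by `x ^ m` gives the condition `IsGrowthRate`; without its term in `k`
it becomes `x ^ 3 - 2 x ^ 2 - x + 1 ≥ 0`, whose largest root is about 2.24698.

TTBR1 is run on at most `k` jobs only, so its cost is a constant for fixed `k`. Space is polynomial
because a call leaves only its result behind, and the recursion depth is linear. -/

theorem Comp.bind_assoc {γ : Type} (m : Comp α) (f : α → Comp β) (g : β → Comp γ) :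
    m >>= f >>= g = m >>= fun a => f a >>= g := by
  simp only [Bind.bind, Comp.mk.injEq, true_and]
  omega

/-- The result of `m` satisfies `Q`; its time is at most `W + X`, it keeps at most `W` cells, and its
peak is at most `W + P`. Here `W` accounts for the work done by the procedure itself, while `X` and
`P` account for time and memory of recursive calls. -/
structure Spec (m : Comp α) (Q : α → Prop) (W : ℕ) (X : ℝ) (P : ℕ) : Prop where
  val : Q m.val
  time : (m.time : ℝ) ≤ W + X
  kept : m.kept ≤ W
  peak : m.peak ≤ W + P

namespace Spec

/-- Own work and the time of calls add up, but `P` does not: a call has released its memory before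
the next one starts, so consecutive calls share the same allowance. -/
theorem bind {m : Comp α} {f : α → Comp β} {Q : α → Prop} {Q' : β → Prop} {W W' : ℕ} {X X' : ℝ}
    {P : ℕ} (h : Spec m Q W X P) (h' : ∀ a, Q a → Spec (f a) Q' W' X' P) :
    Spec (m >>= f) Q' (W + W') (X + X') P := by
  obtain ⟨h1, h2, h3, h4⟩ := h' _ h.val
  refine ⟨h1, ?_, Nat.add_le_add h.kept h3, ?_⟩
  · have := h.time
    change ((m.time + (f m.val).time : ℕ) : ℝ) ≤ _
    push_cast
    linarith
  · have := h.kept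
    have := h.peak
    change max m.peak (m.kept + (f m.val).peak) ≤ _
    omega

theorem mono {m : Comp α} {Q Q' : α → Prop} {W W' : ℕ} {X X' : ℝ} {P P' : ℕ}
    (h : Spec m Q W X P) (hQ : ∀ a, Q a → Q' a) (hW : W ≤ W') (hX : X ≤ X') (hP : P ≤ P') :
    Spec m Q' W' X' P' := by
  refine ⟨hQ _ h.val, h.time.trans ?_, h.kept.trans hW, h.peak.trans (by omega)⟩
  have : (W : ℝ) ≤ W' := by exact_mod_cast hW
  linarith

/-- Weakening of the bound on the work of the procedure itself. -/
theorem weaken {m : Comp α} {Q : α → Prop} {W W' : ℕ} {X X' : ℝ} {P : ℕ}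
    (h : Spec m Q W X P) (hW : W ≤ W') (hX : X ≤ X') : Spec m Q W' X' P :=
  h.mono (fun _ h => h) hW hX le_rfl

theorem post {m : Comp α} {Q Q' : α → Prop} {W : ℕ} {X : ℝ} {P : ℕ}
    (h : Spec m Q W X P) (hQ : ∀ a, Q a → Q' a) : Spec m Q' W X P :=
  h.mono hQ le_rfl le_rfl le_rfl

theorem step {a : α} {Q : α → Prop} {P : ℕ} (h : Q a) : Spec (step a) Q 1 0 P :=
  ⟨h, by simp [TotalTardiness.step], le_rfl, by simp [TotalTardiness.step]⟩

theorem ret {a : α} {P : ℕ} : Spec (TotalTardiness.step a) (· = a) 1 0 P := step rfl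

theorem step_le {a : α} {Q : α → Prop} {W P : ℕ} (h : Q a) (hW : 1 ≤ W) :
    Spec (TotalTardiness.step a) Q W 0 P := (step h).weaken hW le_rfl

/-- A call to a procedure without recursive calls of interest. -/
theorem call_aux {m : Comp (List α)} {Q : List α → Prop} {W N P : ℕ}
    (h : Spec m Q W 0 P) (hN : ∀ l, Q l → l.length ≤ N) : Spec (call m) Q (1 + W + N) 0 P := by
  have hl := hN _ h.val
  refine ⟨h.val, ?_, ?_, ?_⟩
  · have := h.time
    have hl' : (m.val.length : ℝ) ≤ N := by exact_mod_cast hl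
    simp only [call]
    push_cast
    linarith
  · simp only [call]
    omega
  · have := h.peak
    simp only [call]
    omega

/-- A recursive call. -/
theorem call {m : Comp (List α)} {Q : List α → Prop} {W N P : ℕ} {X : ℝ}
    (h : Spec m Q W X P) (hN : ∀ l, Q l → l.length ≤ N) :
    Spec (call m) Q (1 + N) (W + X) (W + P) := by
  have hl := hN _ h.val
  refine ⟨h.val, ?_, ?_, ?_⟩
  · have := h.time
    have hl' : (m.val.length : ℝ) ≤ N := by exact_mod_cast hl
    simp only [TotalTardiness.call]
    push_cast
    linarith
  · simp only [TotalTardiness.call]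
    omega
  · have := h.peak
    simp only [TotalTardiness.call]
    omega

end Spec

/-- The call time `X i` may depend on the iteration, since different positions of the longest job
lead to subproblems of different sizes. Each iteration pays one extra unit for the counter. -/
theorem forLoop_spec {body : ℕ → β → Comp β} {Inv : ℕ → β → Prop} {W P : ℕ} {X : ℕ → ℝ} :
    ∀ (m a : ℕ) (b : β), Inv a b →
      (∀ i b, a ≤ i → i < a + m → Inv i b → Spec (body i b) (Inv (i + 1)) W (X i) P) →
      Spec (forLoop body a m b) (Inv (a + m)) (m * (W + 1) + 1) (∑ i ∈ Finset.Ico a (a + m), X i) P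
  | 0, a, b, hb, _ => (Spec.step hb).weaken (by omega) (by simp)
  | m + 1, a, b, hb, h => by
    have h1 := h a b le_rfl (by omega) hb
    refine ((h1.bind fun b' hb' => (Spec.step (Q := (· = a + 1)) rfl).bind ?_).mono
      (W := W + (1 + (m * (W + 1) + 1))) (Q := Inv (a + 1 + m))
      (X := X a + (0 + ∑ i ∈ Finset.Ico (a + 1) (a + 1 + m), X i)) ?_ ?_ ?_ le_rfl)
    · rintro _ rfl
      exact forLoop_spec m (a + 1) b' hb' fun i b hi hi' => h i b (by omega) (by omega)
    · intro x hx
      rwa [show a + (m + 1) = a + 1 + m by omega]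
    · apply le_of_eq; ring
    · rw [show a + (m + 1) = a + 1 + m by omega,
        Finset.sum_eq_sum_Ico_succ_bot (show a < a + 1 + m by omega)]
      simp

/-! ### List routines -/

theorem length_spec {P : ℕ} : ∀ l : List α, Spec (length l) (· = l.length) (l.length + 1) 0 P
  | [] => Spec.step_le rfl (by simp)
  | _ :: l => ((length_spec l).bind fun _ h => Spec.step (by simp [h])).weaken (by simp) (by simp)

theorem append_spec {P : ℕ} {N : ℕ} : ∀ l l' : List α, l.length ≤ N →
    Spec (append l l') (· = l ++ l') (N + 1) 0 P
  | [], l', _ => Spec.step_le rfl (by omega)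
  | a :: l, l', h => by
    obtain ⟨N, rfl⟩ : ∃ M, N = M + 1 := ⟨N - 1, by simp at h; omega⟩
    exact ((append_spec l l' (N := N) (by simpa using h)).bind
      fun _ h => Spec.step (by simp [h])).weaken le_rfl (by simp)

theorem split_spec {P : ℕ} {N : ℕ} : ∀ (i : ℕ) (l : List α), l.length ≤ N →
    Spec (split i l) (· = (l.take i, l.drop i)) (2 * N + 1) 0 P
  | 0, l, _ => Spec.step_le rfl (by omega)
  | i + 1, [], _ => Spec.step_le rfl (by omega)
  | i + 1, a :: l, h => by
    obtain ⟨N, rfl⟩ : ∃ M, N = M + 1 := ⟨N - 1, by simp at h; omega⟩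
    exact ((split_spec i l (N := N) (by simpa using h)).bind fun _ h => Spec.ret.bind
      fun _ h' => Spec.step (by simp [h, h'])).weaken (by omega) (by simp)

theorem remove_spec {P : ℕ} {N : ℕ} (j : Fin n) : ∀ l : List (Fin n), l.length ≤ N →
    Spec (remove j l) (· = l.erase j) (2 * N + 1) 0 P
  | [], _ => Spec.step_le rfl (by omega)
  | a :: l, h => by
    obtain ⟨N, rfl⟩ : ∃ M, N = M + 1 := ⟨N - 1, by simp at h; omega⟩
    have ih := remove_spec (P := P) j l (N := N) (by simpa using h)
    refine ((Spec.step (Q := (· = decide (a = j))) rfl).bind (W' := 2 * N + 2) (X' := 0) ?_).weaken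
      (by omega) (by simp)
    rintro _ rfl
    by_cases hj : a = j
    · subst hj
      simpa using (Spec.step (by simp)).weaken (by omega) le_rfl
    · rw [List.erase_cons_tail (by simpa using hj)]
      simp only [hj, decide_false, Bool.false_eq_true, if_false]
      exact (ih.bind fun _ h => Spec.step (by simp [h])).weaken (by omega) (by simp)

/-- Total processing time of a list of jobs. -/
def Data.load (I : Data n) (l : List (Fin n)) : ℕ := (l.map I.p).sum

theorem endTime_spec {P : ℕ} (I : Data n) {N : ℕ} : ∀ (t : ℕ) (l : List (Fin n)), l.length ≤ N →
    Spec (endTime I t l) (· = t + I.load l) (2 * N + 1) 0 P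
  | t, [], _ => Spec.step_le rfl (by omega)
  | t, j :: l, h => by
    obtain ⟨N, rfl⟩ : ∃ M, N = M + 1 := ⟨N - 1, by simp at h; omega⟩
    refine (Spec.ret.bind fun q hq => Spec.ret.bind (W' := 2 * N + 1) (X' := 0)
      fun c hc => ?_).weaken (by omega) (by simp)
    subst hq hc
    refine (endTime_spec I _ l (N := N) (by simpa using h)).post fun a ha => ?_
    simp [ha, Data.load, add_assoc]

theorem evalSeq_spec {P : ℕ} (I : Data n) {N : ℕ} : ∀ (t : ℕ) (l : List (Fin n)), l.length ≤ N →
    Spec (evalSeq I t l) (· = I.tardiness t l) (5 * N + 1) 0 P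
  | t, [], _ => Spec.step_le rfl (by omega)
  | t, j :: l, h => by
    obtain ⟨N, rfl⟩ : ∃ M, N = M + 1 := ⟨N - 1, by simp at h; omega⟩
    refine (Spec.ret.bind fun q hq => Spec.ret.bind fun c hc =>
      Spec.ret.bind fun e he => Spec.ret.bind (W' := 5 * N + 2) (X' := 0)
      fun s hs => ?_).weaken (by omega) (by simp)
    subst hq hc he hs
    exact ((evalSeq_spec I _ l (N := N) (by simpa using h)).bind fun a ha =>
      Spec.step (by simp [ha, Data.tardiness])).weaken (by omega) (by simp)

theorem best_spec {P : ℕ} (I : Data n) {N t : ℕ} {σ τ : List (Fin n)} (hσ : σ.length ≤ N)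
    (hτ : τ.length ≤ N) :
    Spec (best I t σ τ) (fun r => (r = σ ∨ r = τ) ∧ I.tardiness t r ≤ I.tardiness t σ ∧
      I.tardiness t r ≤ I.tardiness t τ) (10 * N + 4) 0 P := by
  refine ((evalSeq_spec I t σ hσ).bind fun a ha => (evalSeq_spec I t τ hτ).bind fun b hb =>
    (Spec.step (Q := (· = decide (a ≤ b))) rfl).bind (W' := 1) (X' := 0) fun c hc => ?_).weaken
      (by omega) (by simp)
  subst ha hb hc
  by_cases h : I.tardiness t σ ≤ I.tardiness t τ
  · simpa [h] using Spec.step (by simp [h])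
  · simpa [h] using Spec.step (by simp; omega)

/-! ### EDD order and the longest job -/

/-- The jobs of the list are in nondecreasing order of due dates. -/
def Data.Edd (I : Data n) (l : List (Fin n)) : Prop := l.Pairwise fun i j => I.d i ≤ I.d j

theorem eddBefore_spec {P : ℕ} (I : Data n) (i j : Fin n) :
    Spec (eddBefore I i j) (fun b => if b then I.d i ≤ I.d j else I.d j ≤ I.d i) 7 0 P := by
  refine ((Spec.step (Q := (· = I.d i)) rfl).bind fun a ha =>
    (Spec.step (Q := (· = I.d j)) rfl).bind fun b hb =>
    (Spec.step (Q := (· = decide (a < b))) rfl).bind (W' := 4) (X' := 0) fun c hc => ?_).weaken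
      (by omega) (by simp)
  subst ha hb hc
  by_cases h : I.d i < I.d j
  · simpa [h] using (Spec.step (by simp [h.le])).weaken (by omega) le_rfl
  · simp only [h, decide_false, Bool.false_eq_true, if_false]
    refine ((Spec.step (Q := (· = decide (I.d j < I.d i))) rfl).bind (W' := 3) (X' := 0)
      fun c hc => ?_).weaken (by omega) (by simp)
    subst hc
    by_cases h' : I.d j < I.d i
    · simpa [h'] using (Spec.step (by simp [h'.le])).weaken (by omega) le_rfl
    · simp only [h', decide_false, Bool.false_eq_true, if_false]
      -- The due dates coincide here, so either answer is consistent with the order; the tie-break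
      -- by processing times is irrelevant for correctness.
      refine ((Spec.step (Q := fun _ => True) trivial).bind fun _ _ =>
        (Spec.step (Q := fun _ => True) trivial).bind fun _ _ =>
        Spec.step ?_).weaken (by omega) (by simp)
      split <;> omega

theorem eddInsert_spec {P : ℕ} (I : Data n) {N : ℕ} (j : Fin n) : ∀ l : List (Fin n),
    l.length ≤ N → I.Edd l →
    Spec (eddInsert I j l) (fun r => r.Perm (j :: l) ∧ I.Edd r) (8 * N + 2) 0 P
  | [], _, _ => (Spec.step (by simp [Data.Edd])).weaken (by omega) le_rfl
  | a :: l, h, hl => by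
    obtain ⟨N, rfl⟩ : ∃ M, N = M + 1 := ⟨N - 1, by simp at h; omega⟩
    rw [Data.Edd, List.pairwise_cons] at hl
    refine ((eddBefore_spec I a j).bind (W' := 8 * N + 3) (X' := 0) fun b hb => ?_).weaken
      (by omega) (by simp)
    cases b
    · simp only [Bool.false_eq_true, if_false] at hb ⊢
      refine (Spec.ret.bind fun r hr => Spec.step ?_).weaken (by omega) (by simp)
      subst hr
      refine ⟨.refl _, ?_⟩
      simp only [Data.Edd, List.pairwise_cons, List.mem_cons, forall_eq_or_imp]
      exact ⟨⟨hb, fun x hx => hb.trans (hl.1 x hx)⟩, hl⟩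
    · simp only [if_true] at hb ⊢
      refine ((eddInsert_spec I j l (N := N) (by simpa using h) hl.2).bind fun r hr =>
        Spec.step ?_).weaken (by omega) (by simp)
      refine ⟨(hr.1.cons a).trans (.swap _ _ _), ?_⟩
      rw [Data.Edd, List.pairwise_cons]
      refine ⟨fun x hx => ?_, hr.2⟩
      rcases List.mem_cons.1 (hr.1.subset hx) with rfl | hx
      exacts [hb, hl.1 x hx]

theorem eddSort_spec {P : ℕ} (I : Data n) {N : ℕ} : ∀ l : List (Fin n), l.length ≤ N →
    Spec (eddSort I l) (fun r => r.Perm l ∧ I.Edd r) (l.length * (8 * N + 2) + 1) 0 P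
  | [], _ => (Spec.step (by simp [Data.Edd])).weaken (by omega) le_rfl
  | j :: l, h => by
    have h' : l.length ≤ N := by simp at h; omega
    refine ((eddSort_spec I l h').bind fun r hr => (eddInsert_spec I (N := N) j r ?_ hr.2).post
      fun s hs => ?_).weaken ?_ (by simp)
    · rwa [hr.1.length_eq]
    · exact ⟨hs.1.trans (hr.1.cons j), hs.2⟩
    · apply le_of_eq; simp; ring

/-- Job `j` has position `κ`, counted from `1`, in the list `S`, and it is a longest job of `S`. -/
structure Data.IsLongest (I : Data n) (S : List (Fin n)) (j : Fin n) (κ : ℕ) : Prop where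
  pos : 1 ≤ κ
  get : S[κ - 1]? = some j
  le : ∀ i ∈ S, I.p i ≤ I.p j

/-- The postcondition names the computed value itself, so that separate runs on the same list (in
`child` and in the main loop) are known to find the same job and position. -/
theorem longestAux_cost {P : ℕ} (I : Data n) {N : ℕ} : ∀ (b : Fin n) (κ i : ℕ) (l : List (Fin n)),
    l.length ≤ N → Spec (longestAux I b κ i l) (· = (longestAux I b κ i l).val) (4 * N + 1) 0 P
  | b, κ, i, [], _ => Spec.step_le rfl (by omega)
  | b, κ, i, a :: l, h => by
    obtain ⟨N, rfl⟩ : ∃ M, N = M + 1 := ⟨N - 1, by simp at h; omega⟩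
    have hl : l.length ≤ N := by simpa using h
    refine ((Spec.step (Q := (· = I.p b)) rfl).bind fun q hq =>
      (Spec.step (Q := (· = I.p a)) rfl).bind fun r hr =>
      (Spec.step (Q := (· = decide (I.p b < I.p a))) (by subst hq hr; rfl)).bind fun c hc =>
      (Spec.step (Q := (· = i + 1)) rfl).bind (W' := 4 * N + 1) (X' := 0) fun i' hi => ?_).weaken
      (by omega) (by simp)
    subst hc hi
    by_cases hc : I.p b < I.p a
    · simp only [hc, decide_true, if_true]
      refine (longestAux_cost I a i (i + 1) l hl).post fun x hx => hx.trans ?_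
      simp [longestAux, procTime, lt, add, step, bind, hc]
    · simp only [hc, decide_false, Bool.false_eq_true, if_false]
      refine (longestAux_cost I b κ (i + 1) l hl).post fun x hx => hx.trans ?_
      simp [longestAux, procTime, lt, add, step, bind, hc]

/-- Invariant of the scan: the first `i - 1` jobs of `S` have been read, `l` is the unread rest, and
`b` is a longest job among those read. -/
theorem longestAux_isLongest (I : Data n) : ∀ (b : Fin n) (κ i : ℕ) (l S : List (Fin n)), 1 ≤ i →
    (S.take (i - 1)) ++ l = S → I.IsLongest (S.take (i - 1)) b κ →
    I.IsLongest S (longestAux I b κ i l).val.1 (longestAux I b κ i l).val.2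
  | b, κ, i, [], S, _, hS, h => by
    rw [List.append_nil] at hS
    rw [hS] at h
    exact h
  | b, κ, i, a :: l, S, hi, hS, h => by
    have hlen : (S.take (i - 1)).length = i - 1 := by
      have := congrArg List.length hS
      simp at this ⊢
      omega
    have hget : S[i - 1]? = some a := by
      rw [← hS, List.getElem?_append_right (by omega), hlen]
      simp
    have htake : S.take (i + 1 - 1) = S.take (i - 1) ++ [a] := by
      rw [show i + 1 - 1 = i - 1 + 1 by omega, List.take_add_one, hget]
      rfl
    have hS' : S.take (i + 1 - 1) ++ l = S := by rw [htake]; simpa using hS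
    by_cases hc : I.p b < I.p a
    · have : (longestAux I b κ i (a :: l)).val = (longestAux I a i (i + 1) l).val := by
        simp only [longestAux, procTime, lt, add, step, bind, hc, decide_true, if_true]
      rw [this]
      refine longestAux_isLongest I a i (i + 1) l S (by omega) hS' ⟨hi, ?_, ?_⟩
      · rw [htake, List.getElem?_append_right (by omega), hlen]
        simp
      · intro x hx
        rw [htake] at hx
        rcases List.mem_append.1 hx with hx | hx
        · exact (h.le x hx).trans hc.le
        · simp at hx
          simp [hx]
    · have : (longestAux I b κ i (a :: l)).val = (longestAux I b κ (i + 1) l).val := by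
        simp only [longestAux, procTime, lt, add, step, bind, hc, decide_false,
          Bool.false_eq_true, if_false]
      rw [this]
      refine longestAux_isLongest I b κ (i + 1) l S (by omega) hS' ⟨h.pos, ?_, ?_⟩
      · have := h.get
        rw [htake, List.getElem?_append_left, this]
        exact (List.getElem?_eq_some_iff.1 this).1
      · intro x hx
        rw [htake] at hx
        rcases List.mem_append.1 hx with hx | hx
        · exact h.le x hx
        · simp at hx
          subst hx
          omega

theorem longest_cost {P : ℕ} (I : Data n) {N : ℕ} (a : Fin n) (l : List (Fin n))
    (h : l.length ≤ N) : Spec (longest I a l) (· = (longest I a l).val) (4 * N + 1) 0 P :=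
  longestAux_cost I a 1 2 l h

theorem longest_isLongest (I : Data n) (a : Fin n) (l : List (Fin n)) :
    I.IsLongest (a :: l) (longest I a l).val.1 (longest I a l).val.2 :=
  longestAux_isLongest I a 1 2 l (a :: l) (by omega) rfl ⟨le_rfl, rfl, by simp⟩

/-! ### The elimination test. -/

theorem someLate_spec {P : ℕ} (I : Data n) {N : ℕ} (c : ℕ) : ∀ l : List (Fin n), l.length ≤ N →
    Spec (someLate I c l) (fun b => b = true ↔ ∃ r ∈ l, c < I.d r + I.p r) (5 * N + 1) 0 P
  | [], _ => (Spec.step (by simp)).weaken (by omega) le_rfl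
  | r :: l, h => by
    obtain ⟨N, rfl⟩ : ∃ M, N = M + 1 := ⟨N - 1, by simp at h; omega⟩
    have hl : l.length ≤ N := by simpa using h
    refine ((Spec.step (Q := (· = I.d r)) rfl).bind fun e he =>
      (Spec.step (Q := (· = I.p r)) rfl).bind fun q hq =>
      (Spec.step (Q := (· = I.d r + I.p r)) (by subst he hq; rfl)).bind fun s hs =>
      (Spec.step (Q := (· = decide (c < s))) rfl).bind (W' := 5 * N + 2) (X' := 0)
      fun b hb => ?_).weaken (by omega) (by simp)
    subst hs hb
    by_cases hc : c < I.d r + I.p r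
    · simpa [hc] using (Spec.step (by simp)).weaken (by omega) le_rfl
    · simpa [hc] using ((someLate_spec I c l hl).post (by simp)).weaken (by omega) le_rfl

theorem eliminated_spec {P : ℕ} (I : Data n) {N : ℕ} (κ c : ℕ) (front A : List (Fin n))
    (h : front.length ≤ N) :
    Spec (eliminated I κ c front A) (fun b => b = true ↔ (∃ a ∈ A.head?, I.d a ≤ c) ∨
      ∃ r ∈ front.drop κ, c < I.d r + I.p r) (7 * N + 5) 0 P := by
  refine ((split_spec κ front h).bind (W' := 5 * N + 4) (X' := 0) ?_).weaken (by omega) (by simp)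
  rintro _ rfl
  refine ((someLate_spec I (N := N) c (front.drop κ) (by simp; omega)).bind (W' := 3) (X' := 0)
    fun b hb => ?_).weaken (by omega) (by simp)
  cases A with
  | nil => exact (Spec.step (by simp [hb])).weaken (by omega) le_rfl
  | cons a l =>
    refine ((Spec.step (Q := (· = I.d a)) rfl).bind fun e he =>
      (Spec.step (Q := (· = decide (I.d a ≤ c))) (by subst he; rfl)).bind (W' := 1) (X' := 0)
      fun b' hb' => ?_).weaken (by omega) (by simp)
    subst hb'
    by_cases hc : I.d a ≤ c
    · simpa [hc] using Spec.step (by simp)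
    · simpa [hc] using Spec.step (by simpa [hc] using hb)

/-! ### Positions of the longest job in optimal sequences -/

namespace Data

variable (I : Data n)

@[simp] theorem load_nil : I.load [] = 0 := rfl

@[simp] theorem load_cons (j : Fin n) (l : List (Fin n)) : I.load (j :: l) = I.p j + I.load l := by
  simp [load]

@[simp] theorem load_append (l l' : List (Fin n)) : I.load (l ++ l') = I.load l + I.load l' := by
  simp [load]

variable {I} in
theorem load_perm {l l' : List (Fin n)} (h : l.Perm l') : I.load l = I.load l' :=
  (h.map I.p).sum_eq

theorem tardiness_append : ∀ (t : ℕ) (l l' : List (Fin n)),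
    I.tardiness t (l ++ l') = I.tardiness t l + I.tardiness (t + I.load l) l'
  | t, [], l' => by simp [tardiness]
  | t, j :: l, l' => by simp [tardiness, tardiness_append _ l l', add_assoc]

theorem tardiness_mono : ∀ {t t' : ℕ} (l : List (Fin n)), t ≤ t' →
    I.tardiness t l ≤ I.tardiness t' l
  | _, _, [], _ => le_rfl
  | t, t', j :: l, h => by
    have := tardiness_mono (t := t + I.p j) (t' := t' + I.p j) l (by omega)
    simp only [tardiness]
    omega

/-- Exchanging a job `ℓ` with a later, shorter job `j` that is due no later than `ℓ`, or that is
due when `ℓ` completes. -/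
theorem tardiness_exchange_le (t : ℕ) (u w z : List (Fin n)) {ℓ j : Fin n} (hp : I.p j ≤ I.p ℓ)
    (hd : I.d j ≤ I.d ℓ ∨ I.d j ≤ t + I.load u + I.p ℓ) :
    I.tardiness t (u ++ j :: (w ++ ℓ :: z)) ≤ I.tardiness t (u ++ ℓ :: (w ++ j :: z)) := by
  -- The jobs of `w` start no later than before, and `z` starts at the same time. What remains is an
  -- inequality between the tardinesses of `ℓ` and `j` alone.
  have := I.tardiness_mono (t := t + I.load u + I.p j) (t' := t + I.load u + I.p ℓ) w (by omega)
  simp only [tardiness_append, tardiness]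
  rw [show t + I.load u + I.p ℓ + I.load w + I.p j = t + I.load u + I.p j + I.load w + I.p ℓ by
    omega]
  omega

/-- Moving a job `r` directly behind a later job `ℓ` that is due no later than `r`, when `r` would
start before its due date there. -/
theorem tardiness_postpone_le (t : ℕ) (x y z : List (Fin n)) {ℓ r : Fin n} (hd : I.d ℓ ≤ I.d r)
    (hc : t + I.load (x ++ r :: y) + I.p ℓ < I.d r + I.p r) :
    I.tardiness t (x ++ y ++ ℓ :: r :: z) ≤ I.tardiness t (x ++ r :: y ++ ℓ :: z) := by
  -- The jobs of `y` and `ℓ` start earlier by `p r`, and `r` completes at the old completion time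
  -- `C` of `ℓ`. If `r` is late there, its tardiness `C - d r` is below `p r` and at most `C - d ℓ`,
  -- so the gain of `ℓ` covers it.
  have := I.tardiness_mono (t := t + I.load x) (t' := t + I.load x + I.p r) y (by omega)
  simp only [tardiness_append, tardiness, load_append, load_cons] at hc ⊢
  rw [show t + (I.load x + I.load y) + I.p ℓ + I.p r =
    t + (I.load x + (I.p r + I.load y)) + I.p ℓ by omega]
  omega

/-- Some sequence that is at least as good as a given one has the following property for every job
behind `ℓ`: it is due after `ℓ` and after the completion of `ℓ`. -/
theorem exists_due_after (t : ℕ) {ℓ : Fin n} : ∀ (m : ℕ) (u v : List (Fin n)), v.length = m →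
    (∀ j ∈ v, I.p j ≤ I.p ℓ) →
    ∃ u' v', (u' ++ ℓ :: v').Perm (u ++ ℓ :: v) ∧
      I.tardiness t (u' ++ ℓ :: v') ≤ I.tardiness t (u ++ ℓ :: v) ∧
      ∀ j ∈ v', I.d ℓ < I.d j ∧ t + I.load u' + I.p ℓ < I.d j := by
  intro m
  induction m using Nat.strong_induction_on with
  | _ m ih =>
    intro u v hv hp
    by_cases h : ∀ j ∈ v, I.d ℓ < I.d j ∧ t + I.load u + I.p ℓ < I.d j
    · exact ⟨u, v, .refl _, le_rfl, h⟩
    · push Not at h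
      obtain ⟨j, hj, hd⟩ := h
      obtain ⟨w, z, rfl⟩ := List.append_of_mem hj
      have hle := I.tardiness_exchange_le t u w z (hp j hj) (by
        by_cases h : I.d j ≤ I.d ℓ
        · exact .inl h
        · exact .inr (hd (by omega)))
      -- After the exchange `ℓ` stands where `j` was, with only `z` behind it, so the number of jobs
      -- behind `ℓ` decreases.
      obtain ⟨u', v', h1, h2, h3⟩ := ih z.length (by simp at hv; omega) (u ++ j :: w) z rfl
        (fun i hi => hp i (by simp [hi]))
      refine ⟨u', v', h1.trans ?_, h2.trans (by simpa using hle), h3⟩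
      simp only [List.append_assoc, List.cons_append]
      refine List.Perm.append_left u ?_
      rw [← Multiset.coe_eq_coe]
      simp only [← Multiset.cons_coe, ← Multiset.coe_add]
      simp only [Multiset.add_cons]
      exact Multiset.cons_swap _ _ _

/-- Jobs from a set `Q` that precede `ℓ` and would start before their due date behind `ℓ` can be
postponed. -/
theorem exists_postponed (t : ℕ) {ℓ : Fin n} (Q : Fin n → Prop) (hQ : ∀ r, Q r → I.d ℓ ≤ I.d r) :
    ∀ (m : ℕ) (u v : List (Fin n)), u.length = m →
    (∀ j ∈ v, Q j ∧ t + I.load u + I.p ℓ < I.d j) →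
    ∃ u' v', (u' ++ ℓ :: v').Perm (u ++ ℓ :: v) ∧
      I.tardiness t (u' ++ ℓ :: v') ≤ I.tardiness t (u ++ ℓ :: v) ∧
      (∀ j ∈ v', Q j ∧ t + I.load u' + I.p ℓ < I.d j) ∧
      ∀ r ∈ u', Q r → I.d r + I.p r ≤ t + I.load u' + I.p ℓ := by
  intro m
  induction m using Nat.strong_induction_on with
  | _ m ih =>
    intro u v hu hv
    by_cases h : ∀ r ∈ u, Q r → I.d r + I.p r ≤ t + I.load u + I.p ℓ
    · exact ⟨u, v, .refl _, le_rfl, hv, h⟩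
    · push Not at h
      obtain ⟨r, hr, hr', hd⟩ := h
      obtain ⟨x, y, rfl⟩ := List.append_of_mem hr
      have hle := I.tardiness_postpone_le t x y v (hQ r hr') hd
      -- Postponing `r` lowers the completion time of `ℓ` by `p r`. The condition on `v` therefore
      -- persists, and by `hd` it now holds for `r` as well.
      obtain ⟨u', v', h1, h2, h3⟩ := ih (x ++ y).length (by simp at hu ⊢; omega) (x ++ y) (r :: v)
        rfl (by
          simp only [List.mem_cons, forall_eq_or_imp, load_append, load_cons] at hv hd ⊢
          refine ⟨⟨hr', by omega⟩, fun j hj => ⟨(hv j hj).1, ?_⟩⟩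
          have := (hv j hj).2
          omega)
      refine ⟨u', v', h1.trans ?_, h2.trans hle, h3⟩
      simp only [List.append_assoc, List.cons_append]
      refine List.Perm.append_left x ?_
      rw [← Multiset.coe_eq_coe]
      simp only [← Multiset.cons_coe, ← Multiset.coe_add]
      simp only [Multiset.add_cons]
      rw [Multiset.cons_swap]

/-- Position `i` of the job in position `κ` of `S` is eliminated. -/
def Eliminated (t : ℕ) (S : List (Fin n)) (κ i : ℕ) : Prop :=
  (∃ a ∈ (S.drop i).head?, I.d a ≤ t + I.load (S.take i)) ∨
    ∃ r ∈ (S.take i).drop κ, t + I.load (S.take i) < I.d r + I.p r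

variable {I}

theorem IsLongest.le_length {S : List (Fin n)} {ℓ : Fin n} {κ : ℕ} (h : I.IsLongest S ℓ κ) :
    κ ≤ S.length := by
  have := (List.getElem?_eq_some_iff.1 h.get).1
  have := h.pos
  omega

theorem IsLongest.eq_append {S : List (Fin n)} {ℓ : Fin n} {κ : ℕ} (h : I.IsLongest S ℓ κ) :
    S.take (κ - 1) ++ ℓ :: S.drop κ = S := by
  obtain ⟨h1, h2⟩ := List.getElem?_eq_some_iff.1 h.get
  have : S.drop (κ - 1) = ℓ :: S.drop κ := by
    rw [List.drop_eq_getElem_cons h1, h2, Nat.sub_add_cancel h.pos]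
  rw [← this, List.take_append_drop]

theorem IsLongest.mem_take {S : List (Fin n)} {ℓ : Fin n} {κ i : ℕ} (h : I.IsLongest S ℓ κ)
    (hi : κ ≤ i) : ℓ ∈ S.take i := by
  have := h.pos
  apply List.mem_of_getElem? (i := κ - 1)
  rw [List.getElem?_take_of_lt (by omega), h.get]

/-- The decomposition theorem: every sequence of the jobs of `S` is dominated by one in which the
longest job `ℓ` has an eligible, not eliminated position `i`, the jobs before `ℓ` being those
among the first `i` in EDD order. -/
theorem exists_decomposition {S : List (Fin n)} {ℓ : Fin n} {κ : ℕ} (h : I.IsLongest S ℓ κ)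
    (hS : I.Edd S) (hn : S.Nodup) (t : ℕ) {τ : List (Fin n)} (hτ : τ.Perm S) :
    ∃ i β α, κ ≤ i ∧ i ≤ S.length ∧ ¬ I.Eliminated t S κ i ∧
      β.Perm ((S.take i).erase ℓ) ∧ α.Perm (S.drop i) ∧
      I.tardiness t (β ++ ℓ :: α) ≤ I.tardiness t τ := by
  have hpos := h.pos
  have hκ := h.le_length
  set A := S.take (κ - 1) with hA
  set B := S.drop κ with hB
  have hSe : A ++ ℓ :: B = S := h.eq_append
  have hAlen : A.length = κ - 1 := by simp [hA]; omega
  have hS' := hS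
  have hn' := hn
  rw [← hSe, Edd, List.pairwise_append, List.pairwise_cons] at hS'
  rw [← hSe, List.nodup_append, List.nodup_cons] at hn'
  obtain ⟨-, ⟨hℓB, hBs⟩, hAB⟩ := hS'
  have hAℓ : ∀ a ∈ A, I.d a ≤ I.d ℓ := fun a ha => hAB a ha ℓ (by simp)
  obtain ⟨u, v, rfl⟩ := List.append_of_mem (hτ.mem_iff.2 (h.mem_take le_rfl |> List.mem_of_mem_take))
  -- Every job now behind `ℓ` is due strictly later than `ℓ`; it cannot lie in `A` and hence lies in
  -- `B`. This is what `exists_postponed` needs with `Q` being membership in `B`.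
  obtain ⟨u₁, v₁, p₁, c₁, q₁⟩ := I.exists_due_after t (ℓ := ℓ) _ u v rfl
    (fun j hj => h.le j (hτ.subset (by simp [hj])))
  have n₁ : (u₁ ++ ℓ :: v₁).Nodup := (p₁.trans hτ).nodup_iff.2 hn
  obtain ⟨u₂, v₂, p₂, c₂, q₂, r₂⟩ := I.exists_postponed t (ℓ := ℓ) (· ∈ B) (fun r hr => hℓB r hr)
    _ u₁ v₁ rfl (by
      intro j hj
      refine ⟨?_, (q₁ j hj).2⟩
      have hjS : j ∈ S := (p₁.trans hτ).subset (by simp [hj])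
      rw [← hSe] at hjS
      simp only [List.mem_append, List.mem_cons] at hjS
      rcases hjS with hjA | rfl | hjB
      · have := hAℓ j hjA
        have := (q₁ j hj).1
        omega
      · rw [List.nodup_append, List.nodup_cons] at n₁
        exact absurd hj n₁.2.1.1
      · exact hjB)
  have p₃ := p₂.trans (p₁.trans hτ)
  have n₂ : (u₂ ++ ℓ :: v₂).Nodup := p₃.nodup_iff.2 hn
  set C := t + I.load u₂ + I.p ℓ with hC
  -- Since `B` is sorted by due dates, the threshold `C` cuts it into a prefix and a suffix. The
  -- position of `ℓ` will be `κ + B₁.length`.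
  obtain ⟨B₁, B₂, hB12, hB1, hB2⟩ : ∃ B₁ B₂, B = B₁ ++ B₂ ∧ (∀ j ∈ B₁, I.d j ≤ C) ∧
      ∀ j ∈ B₂, C < I.d j := by
    clear_value B C
    clear * - hBs
    induction B with
    | nil => exact ⟨[], [], rfl, by simp, by simp⟩
    | cons b B ih =>
      rw [List.pairwise_cons] at hBs
      by_cases hb : I.d b ≤ C
      · obtain ⟨B₁, B₂, h1, h2, h3⟩ := ih hBs.2
        exact ⟨b :: B₁, B₂, by simp [h1], by simpa [hb] using h2, h3⟩
      · refine ⟨[], b :: B, rfl, by simp, ?_⟩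
        simp only [List.mem_cons, forall_eq_or_imp]
        exact ⟨by omega, fun j hj => by have := hBs.1 j hj; omega⟩
  have hSe' : S = A ++ ℓ :: (B₁ ++ B₂) := by rw [← hB12, hSe]
  have htake : S.take (κ + B₁.length) = A ++ ℓ :: B₁ := by
    rw [hSe', show A ++ ℓ :: (B₁ ++ B₂) = (A ++ ℓ :: B₁) ++ B₂ by simp]
    apply List.take_left'
    simp [hAlen]; omega
  have hdrop : S.drop (κ + B₁.length) = B₂ := by
    rw [hSe', show A ++ ℓ :: (B₁ ++ B₂) = (A ++ ℓ :: B₁) ++ B₂ by simp]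
    apply List.drop_left'
    simp [hAlen]; omega
  have hmidd : (A ++ ℓ :: B₁).drop κ = B₁ := by
    rw [show A ++ ℓ :: B₁ = (A ++ [ℓ]) ++ B₁ by simp]
    apply List.drop_left'
    simp [hAlen]; omega
  have herase : (A ++ ℓ :: B₁).erase ℓ = A ++ B₁ := by
    rw [List.erase_append_right _ (fun hh => hn'.2.2 ℓ hh ℓ (by simp) rfl), List.erase_cons_head]
  have hmem : ∀ j, (j ∈ u₂ ∨ j = ℓ ∨ j ∈ v₂) ↔ (j ∈ A ∨ j = ℓ ∨ j ∈ B₁ ∨ j ∈ B₂) := by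
    intro j
    have := p₃.mem_iff (a := j)
    rw [hSe'] at this
    simpa using this
  rw [hSe'] at hn
  simp only [List.nodup_append, List.nodup_cons, List.mem_cons, List.mem_append] at hn n₂
  -- Jobs behind `ℓ` are due after `C`, so they belong to `B₂`. Conversely, a job `r` of `B₂` before
  -- `ℓ` would satisfy `d r + p r ≤ C < d r`.
  have hv : v₂.Perm B₂ := by
    rw [List.perm_ext_iff_of_nodup n₂.2.1.2 hn.2.1.2.2.1]
    intro j
    constructor
    · intro hj
      obtain ⟨hjB, hjC⟩ := q₂ j hj
      rw [hB12, List.mem_append] at hjB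
      rcases hjB with hjB | hjB
      · have := hB1 j hjB
        omega
      · exact hjB
    · intro hj
      rcases (hmem j).2 (by simp [hj]) with hju | rfl | hjv
      · have := r₂ j hju (by rw [hB12]; simp [hj])
        have := hB2 j hj
        omega
      · exact absurd (Or.inr hj) hn.2.1.1
      · exact hjv
  have hu : u₂.Perm (A ++ B₁) := by
    have h1 : (u₂ ++ ℓ :: v₂).Perm (A ++ ℓ :: (B₁ ++ B₂)) := hSe' ▸ p₃
    have h2 : (ℓ :: (u₂ ++ v₂)).Perm (ℓ :: (A ++ (B₁ ++ B₂))) :=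
      List.perm_middle.symm.trans (h1.trans List.perm_middle)
    have h3 := h2.cons_inv
    rw [← List.append_assoc] at h3
    exact (List.perm_append_right_iff _).1 ((h3.trans (List.Perm.append_left _ hv.symm)))
  have hload : t + I.load (A ++ ℓ :: B₁) = C := by
    have := load_perm (I := I) hu
    simp at this ⊢
    omega
  refine ⟨κ + B₁.length, u₂, v₂, by omega, ?_, ?_, ?_, ?_, c₂.trans c₁⟩
  · rw [hSe']
    simp [hAlen]
    omega
  · unfold Eliminated
    rw [htake, hdrop, hmidd, hload]
    rintro (⟨a, ha, hle⟩ | ⟨r, hr, hlt⟩)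
    · have := hB2 a (List.mem_of_mem_head? ha)
      omega
    · have hru : r ∈ u₂ := hu.mem_iff.2 (by simp [hr])
      have := r₂ r hru (by rw [hB12]; simp [hr])
      omega
  · rwa [htake, herase]
  · rwa [hdrop]

/-- Of two adjacent eligible positions, one is eliminated. -/
theorem eliminated_or_eliminated_succ (I : Data n) (t : ℕ) (S : List (Fin n)) {κ i : ℕ}
    (hκ : κ ≤ i) (hi : i < S.length) : I.Eliminated t S κ i ∨ I.Eliminated t S κ (i + 1) := by
  have htake : S.take (i + 1) = S.take i ++ [S[i]] := by simp
  have hdrop : (S.take (i + 1)).drop κ = (S.take i).drop κ ++ [S[i]] := by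
    rw [htake, List.drop_append_of_le_length (by simp; omega)]
  -- The job `S[i]` is `[i+1]` when counted from one. If it is due by `C(i)`, test (a) eliminates
  -- `i`; otherwise `C(i+1) = C(i) + p [i+1] < d [i+1] + p [i+1]`, and test (b) eliminates `i + 1`.
  by_cases h : I.d S[i] ≤ t + I.load (S.take i)
  · exact .inl (.inl ⟨S[i], by simp [List.head?_drop, hi], h⟩)
  · refine .inr (.inr ⟨S[i], by simp [hdrop], ?_⟩)
    rw [htake, load_append, load_cons, load_nil]
    omega

end Data

/-! ### Correctness and cost of TTBR1 -/

namespace Data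

variable {I : Data n}

/-- `σ` is a best sequence of the jobs of `S` from time `t`. -/
def Solves (I : Data n) (t : ℕ) (S σ : List (Fin n)) : Prop :=
  σ.Perm S ∧ ∀ τ, τ.Perm S → I.tardiness t σ ≤ I.tardiness t τ

theorem Edd.sublist {S S' : List (Fin n)} (h : I.Edd S) (hs : S'.Sublist S) : I.Edd S' :=
  List.Pairwise.sublist hs h

theorem IsLongest.perm_take {S β : List (Fin n)} {ℓ : Fin n} {κ i : ℕ} (h : I.IsLongest S ℓ κ)
    (hi : κ ≤ i) (hβ : β.Perm ((S.take i).erase ℓ)) : (β ++ [ℓ]).Perm (S.take i) :=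
  (List.perm_append_singleton ℓ β).trans
    ((hβ.cons ℓ).trans (List.perm_cons_erase (h.mem_take hi)).symm)

theorem IsLongest.perm_append {S β α : List (Fin n)} {ℓ : Fin n} {κ i : ℕ}
    (h : I.IsLongest S ℓ κ) (hi : κ ≤ i) (hβ : β.Perm ((S.take i).erase ℓ))
    (hα : α.Perm (S.drop i)) : (β ++ ℓ :: α).Perm S := by
  have := (h.perm_take hi hβ).append hα
  rw [List.take_append_drop] at this
  simpa using this

theorem IsLongest.length_erase {S : List (Fin n)} {ℓ : Fin n} {κ i : ℕ} (h : I.IsLongest S ℓ κ)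
    (hi : κ ≤ i) (hm : i ≤ S.length) : ((S.take i).erase ℓ).length = i - 1 := by
  rw [List.length_erase_of_mem (h.mem_take hi)]
  simp [hm]

/-- Combining best sequences of the jobs before and after `ℓ`. -/
theorem IsLongest.tardiness_combine_le {S β α left right : List (Fin n)} {ℓ : Fin n} {κ i t : ℕ}
    (h : I.IsLongest S ℓ κ) (hi : κ ≤ i) (hl : I.Solves t ((S.take i).erase ℓ) left)
    (hr : I.Solves (t + I.load (S.take i)) (S.drop i) right)
    (hβ : β.Perm ((S.take i).erase ℓ)) (hα : α.Perm (S.drop i)) :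
    I.tardiness t (left ++ ℓ :: right) ≤ I.tardiness t (β ++ ℓ :: α) := by
  have h1 := load_perm (I := I) (h.perm_take hi hβ)
  have h2 := load_perm (I := I) (h.perm_take hi hl.1)
  have h3 := hl.2 β hβ
  have h4 := hr.2 α hα
  simp only [load_append, load_cons, load_nil] at h1 h2
  simp only [tardiness_append, tardiness]
  rw [show t + I.load left + I.p ℓ = t + I.load (S.take i) by omega,
    show t + I.load β + I.p ℓ = t + I.load (S.take i) by omega]
  omega

end Data

/-- Bound on the cost of TTBR1 with a given depth of the recursion on at most `N` jobs. -/
def ttbr1Cost (N : ℕ) : ℕ → ℕ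
  | 0 => 1
  | depth + 1 => N * (19 * N + 2 * ttbr1Cost N depth + 12) + 5 * N + 5

/-- Loop invariant: the current sequence beats every sequence with `ℓ` in an eligible position
already visited. After all eligible positions, `exists_decomposition` makes it optimal. `N` stays
fixed while the depth decreases, so the cost recursion has a single variable. -/
theorem ttbr1_spec (I : Data n) {N P : ℕ} : ∀ (depth : ℕ) (S : List (Fin n)) (t : ℕ),
    S.length ≤ depth → S.length ≤ N → I.Edd S → S.Nodup →
    Spec (ttbr1 I depth S t) (I.Solves t S) (ttbr1Cost N depth) 0 P
  | 0, S, t, h, _, _, _ => by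
    obtain rfl : S = [] := by simpa using h
    refine Spec.step ⟨.refl _, fun τ hτ => ?_⟩
    rw [hτ.eq_nil]
  | depth + 1, [], t, _, _, _, _ => by
    refine Spec.step_le ⟨.refl _, fun τ hτ => ?_⟩ (by simp only [ttbr1Cost]; omega)
    rw [hτ.eq_nil]
  | depth + 1, a :: l, t, h, hN, hS, hn => by
    have hlong := longest_isLongest I a l
    rcases hv : (longest I a l).val with ⟨ℓ, κ⟩
    rw [hv] at hlong
    simp only at hlong
    have hκ := hlong.le_length
    have hpos := hlong.pos
    have h1 : Spec (longest I a l) (· = (ℓ, κ)) (4 * N + 1) 0 P :=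
      hv ▸ longest_cost I a l (by simp at hN; omega)
    refine (h1.bind (W' := N + 4 + N * (19 * N + 2 * ttbr1Cost N depth + 12)) (X' := 0)
      ?_).weaken (by simp only [ttbr1Cost]; omega) (by simp)
    rintro _ rfl
    simp only
    refine ((length_spec (a :: l)).bind fun m hm => (Spec.ret (a := m + 1)).bind fun m' hm' =>
      (Spec.ret (a := m' - κ)).bind (W' := 1 + N * (19 * N + 2 * ttbr1Cost N depth + 12))
      fun count hc => ?_).weaken (X := 0 + (0 + (0 + 0))) (by omega) (by simp)
    subst hm hm' hc
    generalize a :: l = S at *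
    have hloop := forLoop_spec (P := P) (W := 19 * N + 2 * ttbr1Cost N depth + 11)
      (X := fun _ => 0) (Inv := fun i σ => σ.Perm S ∧ ∀ i', κ ≤ i' → i' < i → ∀ β α,
        β.Perm ((S.take i').erase ℓ) → α.Perm (S.drop i') →
        I.tardiness t σ ≤ I.tardiness t (β ++ ℓ :: α))
      (body := fun i seqOpt => do
        let (front, A) ← split i S
        let B ← remove ℓ front
        let c ← endTime I t front
        let left ← call (ttbr1 I depth B t)
        let right ← call (ttbr1 I depth A c)
        let tail ← cons ℓ right
        let seqCurrent ← append left tail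
        best I t seqOpt seqCurrent) (S.length + 1 - κ) κ S
      ⟨.refl _, fun i' h1 h2 => by omega⟩ ?_
    · refine hloop.mono (fun σ hσ => ⟨hσ.1, fun τ hτ => ?_⟩) ?_ (by simp) le_rfl
      · obtain ⟨i, β, α, hi, hi', -, hβ, hα, hle⟩ := Data.exists_decomposition hlong hS hn t hτ
        exact (hσ.2 i hi (by omega) β α hβ hα).trans hle
      · have : (S.length + 1 - κ) * (19 * N + 2 * ttbr1Cost N depth + 11 + 1) ≤
            N * (19 * N + 2 * ttbr1Cost N depth + 12) := Nat.mul_le_mul_right _ (by omega)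
        omega
    · intro i σ hi hi' hσ
      have hBl := hlong.length_erase hi (by omega)
      refine ((split_spec i S hN).bind (W' := 17 * N + 2 * ttbr1Cost N depth + 10) (X' := 0)
        ?_).weaken (by omega) (by simp)
      rintro _ rfl
      simp only
      refine ((remove_spec ℓ (S.take i) (N := N) (by simp; omega)).bind fun B hB =>
        (endTime_spec I t (S.take i) (N := N) (by simp; omega)).bind
        (W' := 13 * N + 2 * ttbr1Cost N depth + 8) (X' := 0) fun c hc => ?_).weaken
        (by omega) (by simp)
      subst hB hc
      have hl := ttbr1_spec I (P := P) (N := N) depth ((S.take i).erase ℓ) t (by omega) (by omega)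
        (hS.sublist (List.erase_sublist.trans (List.take_sublist _ _)))
        (hn.sublist (List.erase_sublist.trans (List.take_sublist _ _)))
      have hr := ttbr1_spec I (P := P) (N := N) depth (S.drop i) (t + I.load (S.take i))
        (by simp; omega) (by simp; omega) (hS.sublist (List.drop_sublist _ _))
        (hn.sublist (List.drop_sublist _ _))
      -- The recursive calls are charged to the own work `W`: TTBR1 will only be applied to
      -- boundedly many jobs, so no sharper accounting is needed.
      refine ((hl.call_aux (N := N) ?_).bind fun left hleft => (hr.call_aux (N := N) ?_).bind
        fun right hright => Spec.ret.bind fun tail htail =>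
        (append_spec left tail (N := N) ?_).bind fun σ' hσ' =>
        (best_spec I (N := N) ?_ ?_).post ?_).weaken (by omega) (by simp)
      · intro x hx
        rw [hx.1.length_eq]
        omega
      · intro x hx
        rw [hx.1.length_eq]
        simp
        omega
      · rw [hleft.1.length_eq]
        omega
      · rwa [hσ.1.length_eq]
      all_goals
        subst htail hσ'
        have hp := hlong.perm_append hi hleft.1 hright.1
      · rwa [hp.length_eq]
      · rintro ρ ⟨hρ, h1, h2⟩
        refine ⟨?_, fun i' hκi hi'' β α hβ hα => ?_⟩
        · rcases hρ with rfl | rfl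
          exacts [hσ.1, hp]
        · rcases Nat.lt_succ_iff_lt_or_eq.1 hi'' with hlt | rfl
          · exact h1.trans (hσ.2 i' hκi hlt β α hβ hα)
          · exact h2.trans (hlong.tardiness_combine_le hi hleft hright hβ hα)

/-! ### Children of a node and their merging -/

/-- `c` can serve as the `j`-th child of the node `(π, S)`: it fixes the right jobs, and if
position `j` of the longest job is eligible, then it is at least as good as every sequence that
puts the longest job there. -/
structure Branches (I : Data n) (t : ℕ) (π S : List (Fin n)) (j : ℕ)
    (c : Option (List (Fin n))) : Prop where
  perm : ∀ σ ∈ c, σ.Perm (π ++ S.take j)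
  le : ∀ a l, S = a :: l → (longest I a l).val.2 ≤ j → ∃ σ ∈ c, ∀ β : List (Fin n),
    β.Perm ((S.take j).erase (longest I a l).val.1) →
    I.tardiness t σ ≤ I.tardiness t (π ++ (β ++ [(longest I a l).val.1]))

/-- Bound on the cost of computing a child by branching. -/
def childCost (n k : ℕ) : ℕ := 13 * n + 10 + ttbr1Cost k k

theorem child_spec (I : Data n) {k t j P : ℕ} {π S : List (Fin n)} (hS : I.Edd S) (hn : S.Nodup)
    (hlen : π.length + S.length ≤ n) (hj : j ≤ k) :
    Spec (child I k t π S j) (Branches I t π S j) (childCost n k) 0 P := by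
  cases S with
  | nil =>
    exact Spec.step_le ⟨by simp, by simp⟩ (by simp only [childCost]; omega)
  | cons a l =>
    have hlong := longest_isLongest I a l
    have hbr : ∀ c : Option (List (Fin n)), (∀ σ ∈ c, σ.Perm (π ++ (a :: l).take j)) →
        ((longest I a l).val.2 ≤ j → ∃ σ ∈ c, ∀ β : List (Fin n),
          β.Perm (((a :: l).take j).erase (longest I a l).val.1) →
          I.tardiness t σ ≤ I.tardiness t (π ++ (β ++ [(longest I a l).val.1]))) →
        Branches I t π (a :: l) j c := by
      intro c h1 h2
      refine ⟨h1, fun a' l' h => ?_⟩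
      obtain ⟨rfl, rfl⟩ := List.cons.inj h
      exact h2
    have h1 := longest_cost I (P := P) (N := n) a l (by simp at hlen; omega)
    rcases hv : (longest I a l).val with ⟨ℓ, κ⟩
    rw [hv] at hlong h1 hbr
    simp only at hlong hbr
    refine (h1.bind (W' := 9 * n + 9 + ttbr1Cost k k) (X' := 0) ?_).weaken
      (by simp only [childCost]; omega) (by simp)
    rintro _ rfl
    simp only
    generalize a :: l = S at *
    refine ((Spec.ret (a := decide (κ ≤ j))).bind (W' := 9 * n + 8 + ttbr1Cost k k) (X' := 0)
      ?_).weaken (by omega) (by simp)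
    rintro _ rfl
    by_cases hκ : κ ≤ j
    swap
    · simp only [hκ, decide_false, Bool.false_eq_true, if_false]
      exact Spec.step_le (hbr _ (by simp) (fun h => absurd h hκ)) (by omega)
    · simp only [hκ, decide_true, if_true]
      refine ((split_spec (N := n) j S (by omega)).bind (W' := 7 * n + 7 + ttbr1Cost k k)
        (X' := 0) ?_).weaken (by omega) (by simp)
      rintro _ rfl
      simp only
      have hsub : ((S.take j).erase ℓ).Sublist S :=
        List.erase_sublist.trans (List.take_sublist _ _)
      have hBk : ((S.take j).erase ℓ).length ≤ k :=
        List.length_erase_le.trans (by simp; omega)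
      have hl := ttbr1_spec I (P := P) (N := k) k ((S.take j).erase ℓ) (t + I.load π) hBk hBk
        (hS.sublist hsub) (hn.sublist hsub)
      refine ((remove_spec ℓ (S.take j) (N := n) (by simp; omega)).bind fun B hB =>
        (endTime_spec I t π (N := n) (by omega)).bind (W' := 3 * n + 5 + ttbr1Cost k k)
        (X' := 0) fun t' ht' => ?_).weaken (by omega) (by simp)
      subst hB ht'
      have hBn : ((S.take j).erase ℓ).length ≤ n := hsub.length_le.trans (by omega)
      refine ((hl.call_aux (N := n) ?_).bind fun left hleft => Spec.ret.bind fun tail htail =>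
        (append_spec left tail (N := n) ?_).bind fun mid hmid =>
        (append_spec π mid (N := n) ?_).bind fun r hr => Spec.step ?_).weaken
        (by omega) (by simp)
      · intro x hx
        rwa [hx.1.length_eq]
      · rwa [hleft.1.length_eq]
      · omega
      · subst htail hmid hr
        refine hbr _ ?_ fun _ => ⟨_, rfl, fun β hβ => ?_⟩
        · rintro σ ⟨⟩
          exact (hlong.perm_take hκ hleft.1).append_left π
        · have h2 := hleft.2 β hβ
          have h3 := Data.load_perm (I := I) (hleft.1.trans hβ.symm)
          simp only [Data.tardiness_append, h3]
          omega

theorem childrenFrom_spec (I : Data n) {k t P : ℕ} {π S : List (Fin n)} (hS : I.Edd S)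
    (hn : S.Nodup) (hlen : π.length + S.length ≤ n) : ∀ j m : ℕ, j + m ≤ k + 1 →
    Spec (childrenFrom I k t π S j m) (fun C => C.length = m ∧ ∀ i c, C[i]? = some c →
      Branches I t π S (j + i) c) (m * (childCost n k + 2) + 1) 0 P
  | j, 0, _ => Spec.step_le (by simp) (by omega)
  | j, m + 1, h => by
    refine ((child_spec I hS hn hlen (by omega)).bind fun c hc =>
      (Spec.ret (a := j + 1)).bind (W' := m * (childCost n k + 2) + 2) (X' := 0)
      fun j' hj' => ?_).weaken (by rw [Nat.add_mul]; omega) (by simp)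
    subst hj'
    refine ((childrenFrom_spec I hS hn hlen (j + 1) m (by omega)).bind fun C hC =>
      Spec.step ?_).weaken (by omega) (by simp)
    refine ⟨by simp [hC.1], ?_⟩
    rintro (_ | i) c' hc'
    · simp at hc'
      subst hc'
      exact hc
    · rw [show j + (i + 1) = j + 1 + i by omega]
      exact hC.2 i c' (by simpa using hc')

/-- The list of merged children of a node is empty or consists of the first `k - 1` children. -/
def IsChildList (I : Data n) (k t : ℕ) (π S : List (Fin n)) (L : List (Option (List (Fin n)))) :
    Prop :=
  L = [] ∨ L.length = k - 1 ∧ ∀ i c, L[i]? = some c → Branches I t π S (i + 1) c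

/-- Index `i` of the list holds child `i + 1`. The last conjunct keeps the merged nodes among the
children, so that exploring the children also establishes `NodeSolution.le_list`. -/
theorem firstChildren_spec (I : Data n) {k t P : ℕ} {π S : List (Fin n)} (hk : 2 ≤ k)
    (hS : I.Edd S) (hn : S.Nodup) (hlen : π.length + S.length ≤ n)
    {L : List (Option (List (Fin n)))} (hL : IsChildList I k t π S L) :
    Spec (firstChildren I k t π S L) (fun C => C.length = k ∧
      (∀ i c, C[i]? = some c → Branches I t π S (i + 1) c) ∧
      ∀ (i : ℕ) c, L[i]? = some c → C[i]? = some c) (k * (childCost n k + 2) + k + 2) 0 P := by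
  cases L with
  | nil =>
    refine ((childrenFrom_spec I hS hn hlen 1 k (by omega)).post fun C hC => ?_).weaken
      (by omega) le_rfl
    refine ⟨hC.1, fun i c hc => ?_, by simp⟩
    rw [Nat.add_comm i 1]
    exact hC.2 i c hc
  | cons x L =>
    obtain hL | ⟨hL, hL'⟩ := hL
    · cases hL
    refine ((childrenFrom_spec I hS hn hlen k 1 le_rfl).bind fun r hr =>
      (append_spec (N := k) (x :: L) r (by omega)).post ?_).weaken ?_ (by simp)
    · rintro _ rfl
      refine ⟨by rw [List.length_append, hL, hr.1]; omega, fun i c hc => ?_, fun i c hc => ?_⟩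
      · rcases lt_or_ge i (x :: L).length with hi | hi
        · rw [List.getElem?_append_left hi] at hc
          exact hL' i c hc
        · rw [List.getElem?_append_right hi] at hc
          have hi' := (List.getElem?_eq_some_iff.1 hc).1
          have := hr.2 _ c hc
          rwa [show k + (i - (x :: L).length) = i + 1 by omega] at this
      · rw [List.getElem?_append_left (List.getElem?_eq_some_iff.1 hc).1, hc]
    · have : 1 * (childCost n k + 2) ≤ k * (childCost n k + 2) :=
        Nat.mul_le_mul_right _ (by omega)
      omega

/-- `z` is the better one of the nodes `x` and `y`. -/
structure Merged (I : Data n) (t : ℕ) (x y z : Option (List (Fin n))) : Prop where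
  eq_or_eq : z = x ∨ z = y
  le_left : ∀ σ ∈ x, ∃ ρ ∈ z, I.tardiness t ρ ≤ I.tardiness t σ
  le_right : ∀ σ ∈ y, ∃ ρ ∈ z, I.tardiness t ρ ≤ I.tardiness t σ

theorem bestNode_spec (I : Data n) {t N P : ℕ} {x y : Option (List (Fin n))}
    (hx : ∀ σ ∈ x, σ.length ≤ N) (hy : ∀ σ ∈ y, σ.length ≤ N) :
    Spec (bestNode I t x y) (Merged I t x y) (10 * N + 5) 0 P := by
  rcases x with _ | σ
  · exact Spec.step_le ⟨.inr rfl, by simp, fun σ hσ => ⟨σ, hσ, le_rfl⟩⟩ (by omega)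
  · rcases y with _ | τ
    · exact Spec.step_le ⟨.inl rfl, fun σ hσ => ⟨σ, hσ, le_rfl⟩, by simp⟩ (by omega)
    · refine ((best_spec I (N := N) (hx σ rfl) (hy τ rfl)).bind fun r hr =>
        Spec.step ?_).weaken (by omega) (by simp)
      refine ⟨hr.1.imp (congrArg some) (congrArg some), ?_, ?_⟩
      · rintro _ ⟨⟩
        exact ⟨r, rfl, hr.2.1⟩
      · rintro _ ⟨⟩
        exact ⟨r, rfl, hr.2.2⟩

theorem mergeNodes_spec (I : Data n) {t N P : ℕ} : ∀ X Y : List (Option (List (Fin n))),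
    X.length = Y.length → (∀ x ∈ X, ∀ σ ∈ x, σ.length ≤ N) → (∀ y ∈ Y, ∀ σ ∈ y, σ.length ≤ N) →
    Spec (mergeNodes I t X Y) (fun Z => Z.length = X.length ∧ ∀ (i : ℕ) z, Z[i]? = some z →
      ∃ x y, X[i]? = some x ∧ Y[i]? = some y ∧ Merged I t x y z)
      (X.length * (10 * N + 6) + 1) 0 P
  | [], _, _, _, _ => Spec.step_le (by simp) (by omega)
  | x :: X, [], h, _, _ => by simp at h
  | x :: X, y :: Y, h, hX, hY => by
    refine ((bestNode_spec I (N := N) (hX x (by simp)) (hY y (by simp))).bind fun z hz =>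
      (mergeNodes_spec I X Y (by simpa using h) (fun x hx => hX x (by simp [hx]))
        (fun y hy => hY y (by simp [hy]))).bind fun Z hZ => Spec.step ?_).weaken ?_ (by simp)
    · refine ⟨by simp [hZ.1], ?_⟩
      rintro (_ | i) z' hz'
      · simp at hz'
        subst hz'
        exact ⟨x, y, rfl, rfl, hz⟩
      · simpa using hZ.2 i z' (by simpa using hz')
    · rw [List.length_cons, Nat.add_mul]
      omega

/-- Entry `i` of `others` is child `i + 2` of the node, and entry `i` of `own` is child `i + 1` of
the first child; both fix the jobs of `π` and `[1], ..., [i+2]`. The better one inherits the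
branching guarantee of the latter and dominates the former. -/
theorem leftMerge_spec (I : Data n) {k t P : ℕ} {π S π₁ : List (Fin n)}
    (hS : I.Edd S) (hn : S.Nodup) (hlen : π.length + S.length ≤ n)
    (hπ₁ : π₁.Perm (π ++ S.take 1)) {others : List (Option (List (Fin n)))}
    (ho : others.length = k - 1)
    (ho' : ∀ (i : ℕ) (σ : List (Fin n)), others[i]? = some (some σ) → σ.Perm (π ++ S.take (i + 2))) :
    Spec (leftMerge I k t π₁ (S.drop 1) others) (fun L => IsChildList I k t π₁ (S.drop 1) L ∧
      ∀ (i : ℕ) σ, others[i]? = some (some σ) → ∃ ρ, L[i]? = some (some ρ) ∧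
        ρ.Perm σ ∧ I.tardiness t ρ ≤ I.tardiness t σ)
      (k * (childCost n k + 2) + k * (10 * n + 6) + 3) 0 P := by
  have hlen₁ : π₁.length + (S.drop 1).length ≤ n := by
    have := (hπ₁.append_right (S.drop 1)).length_eq
    simp only [List.append_assoc, List.take_append_drop, List.length_append] at this
    omega
  have hperm : ∀ i, (π₁ ++ (S.drop 1).take i).Perm (π ++ S.take (i + 1)) := by
    intro i
    have h1 : S.take (i + 1) = S.take 1 ++ (S.drop 1).take i := by
      rw [Nat.add_comm, List.take_add]
    rw [h1, ← List.append_assoc]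
    exact hπ₁.append_right _
  have hle : ∀ i, (π ++ S.take i).length ≤ n := by
    intro i
    simp
    omega
  refine ((Spec.ret (a := k - 1)).bind
    (W' := k * (childCost n k + 2) + k * (10 * n + 6) + 2) (X' := 0) ?_).weaken
      (by omega) (by simp)
  rintro _ rfl
  refine ((childrenFrom_spec I (k := k) (π := π₁) (S := S.drop 1) (hS.sublist (List.drop_sublist _ _))
    (hn.sublist (List.drop_sublist _ _)) hlen₁ 1 (k - 1) (by omega)).bind fun own hown =>
    (mergeNodes_spec I (N := n) others own (by rw [ho, hown.1]) ?_ ?_).post ?_).weaken ?_ (by simp)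
  · intro x hx σ hσ
    obtain ⟨i, hi⟩ := List.mem_iff_getElem?.1 hx
    obtain rfl : x = some σ := hσ
    rw [(ho' i σ hi).length_eq]
    exact hle _
  · intro x hx σ hσ
    obtain ⟨i, hi⟩ := List.mem_iff_getElem?.1 hx
    rw [(((hown.2 i x hi).perm σ hσ).trans (hperm _)).length_eq]
    exact hle _
  · rintro Z ⟨hZ, hZ'⟩
    refine ⟨.inr ⟨hZ.trans ho, fun i z hz => ?_⟩, fun i σ hσ => ?_⟩
    · obtain ⟨x, y, hx, hy, hm⟩ := hZ' i z hz
      have hb := hown.2 i y hy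
      rw [Nat.add_comm 1 i] at hb
      refine ⟨fun σ hσ => ?_, fun a l hal hκ => ?_⟩
      · rcases hm.eq_or_eq with rfl | rfl
        · obtain rfl : z = some σ := hσ
          exact (ho' i σ hx).trans (hperm (i + 1)).symm
        · exact hb.perm σ hσ
      · obtain ⟨σ, hσ, hσ'⟩ := hb.le a l hal hκ
        obtain ⟨ρ, hρ, hρ'⟩ := hm.le_right σ hσ
        exact ⟨ρ, hρ, fun β hβ => hρ'.trans (hσ' β hβ)⟩
    · have hi : i < Z.length := by
        rw [hZ]
        exact (List.getElem?_eq_some_iff.1 hσ).1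
      obtain ⟨x, y, hx, hy, hm⟩ := hZ' i Z[i] (List.getElem?_eq_getElem hi)
      obtain rfl : x = some σ := Option.some.inj (hx.symm.trans hσ)
      obtain ⟨ρ, hρ, hρ'⟩ := hm.le_left σ rfl
      refine ⟨ρ, by rw [List.getElem?_eq_getElem hi]; exact congrArg some hρ, ?_, hρ'⟩
      rcases hm.eq_or_eq with h | h
      · rw [h] at hρ
        cases hρ
        exact .refl _
      · rw [h] at hρ
        have := (hown.2 i y hy).perm ρ hρ
        rw [Nat.add_comm 1 i] at this
        exact this.trans ((hperm (i + 1)).trans (ho' i σ hσ).symm)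
  · have h1 := Nat.mul_le_mul_right (childCost n k + 2) (Nat.sub_le k 1)
    have h2 := Nat.mul_le_mul_right (10 * n + 6) (Nat.sub_le k 1)
    rw [ho]
    omega

/-- The guarantee `G` of a single solution is left abstract, as the lemma serves both completion by
TTBR1 and recursive exploration. Nonnegativity of `X` lets missing nodes be charged as well. -/
theorem explore_spec (I : Data n) {t N W P : ℕ}
    {solve : List (Fin n) → List (Fin n) → Comp (List (Fin n))} {S J : List (Fin n)}
    (hS : S.length ≤ N) (hJ : J.length ≤ N) (G : ℕ → List (Fin n) → List (Fin n) → Prop)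
    (X : ℕ → ℝ) (hX : ∀ i, 0 ≤ X i) : ∀ (j : ℕ) (L : List (Option (List (Fin n))))
    (seqOpt : List (Fin n)), seqOpt.Perm J →
    (∀ i π, L[i]? = some (some π) → Spec (call (solve π (S.drop (j + i))))
      (fun σ => σ.Perm J ∧ G (j + i) π σ) W (X (j + i)) P) →
    Spec (explore I t solve S j L seqOpt) (fun r => r.Perm J ∧
      I.tardiness t r ≤ I.tardiness t seqOpt ∧ ∀ i π, L[i]? = some (some π) →
      ∃ σ, G (j + i) π σ ∧ I.tardiness t r ≤ I.tardiness t σ)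
      (L.length * (12 * N + 6 + W) + 1) (∑ i ∈ Finset.range L.length, X (j + i)) P
  | j, [], seqOpt, h, _ => (Spec.step (by simp [h])).weaken (by omega) (by simp)
  | j, none :: L, seqOpt, h, hs => by
    refine ((Spec.ret (a := j + 1)).bind fun j' hj' => ?_).weaken
      (W := 1 + (L.length * (12 * N + 6 + W) + 1))
      (X := 0 + ∑ i ∈ Finset.range L.length, X (j + 1 + i)) ?_ ?_
    · subst hj'
      refine (explore_spec I hS hJ G X hX (j + 1) L seqOpt h fun i π hi => ?_).post ?_
      · rw [Nat.add_right_comm]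
        exact hs (i + 1) π (by simpa using hi)
      · rintro r ⟨h1, h2, h3⟩
        refine ⟨h1, h2, ?_⟩
        rintro (_ | i) π hi
        · simp at hi
        · rw [← Nat.add_assoc, Nat.add_right_comm]
          exact h3 i π (by simpa using hi)
    · rw [List.length_cons, Nat.add_mul]
      omega
    · rw [List.length_cons, Finset.sum_range_succ']
      have := hX (j + 0)
      simp only [Nat.add_right_comm j 1, ← Nat.add_assoc] at this ⊢
      linarith
  | j, some π :: L, seqOpt, h, hs => by
    refine ((split_spec j S hS).bind fun sp hsp => ?_).weaken
      (W := (2 * N + 1) + (W + ((10 * N + 4) + (1 + (L.length * (12 * N + 6 + W) + 1)))))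
      (X := 0 + (X j + (0 + (0 + ∑ i ∈ Finset.range L.length, X (j + 1 + i))))) ?_ ?_
    · subst hsp
      have h0 := hs 0 π rfl
      rw [Nat.add_zero] at h0
      refine h0.bind fun σ hσ => (best_spec I (N := N) (by rwa [h.length_eq])
        (by rwa [hσ.1.length_eq])).bind fun so hso => (Spec.ret (a := j + 1)).bind fun j' hj' => ?_
      subst hj'
      have hsoJ : so.Perm J := by rcases hso.1 with rfl | rfl <;> [exact h; exact hσ.1]
      refine (explore_spec I hS hJ G X hX (j + 1) L so hsoJ fun i π hi => ?_).post ?_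
      · rw [Nat.add_right_comm]
        exact hs (i + 1) π (by simpa using hi)
      · rintro r ⟨h1, h2, h3⟩
        refine ⟨h1, h2.trans hso.2.1, ?_⟩
        rintro (_ | i) π' hi
        · simp at hi
          subst hi
          exact ⟨σ, hσ.2, h2.trans hso.2.2⟩
        · rw [← Nat.add_assoc, Nat.add_right_comm]
          exact h3 i π' (by simpa using hi)
    · rw [List.length_cons, Nat.add_mul]
      omega
    · rw [List.length_cons, Finset.sum_range_succ']
      simp only [Nat.add_right_comm j 1, ← Nat.add_assoc, Nat.add_zero]
      linarith

theorem completeSmall_spec (I : Data n) {k t P : ℕ} {π S : List (Fin n)} (hS : I.Edd S)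
    (hn : S.Nodup) (hlen : π.length + S.length ≤ n) (hk : S.length ≤ k) :
    Spec (completeSmall I k t π S) (fun σ => σ.Perm (π ++ S) ∧
      ∀ τ, τ.Perm S → I.tardiness t σ ≤ I.tardiness t (π ++ τ)) (4 * n + 3 + ttbr1Cost k k) 0 P := by
  refine ((endTime_spec I t π (N := n) (by omega)).bind
    (W' := 2 * n + 2 + ttbr1Cost k k) (X' := 0) fun t' ht' => ?_).weaken (by omega) (by simp)
  subst ht'
  refine (((ttbr1_spec I (N := k) k S _ hk hk hS hn).call_aux (N := n) ?_).bind fun σ hσ =>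
    (append_spec (N := n) π σ (by omega)).post ?_).weaken (by omega) (by simp)
  · intro σ hσ
    rw [hσ.1.length_eq]
    omega
  · rintro _ rfl
    refine ⟨hσ.1.append_left π, fun τ hτ => ?_⟩
    have := hσ.2 τ hτ
    simp only [Data.tardiness_append]
    omega

/-! ### The recurrence -/

/-- A sum of powers in which no two adjacent exponents occur. -/
theorem sum_pow_of_not_adjacent {x : ℝ} (hx : 2 ≤ x) (F : ℕ → Prop) [DecidablePred F] : ∀ m : ℕ,
    (∀ j, j + 1 < m → F j → ¬ F (j + 1)) →
    ∑ j ∈ Finset.range m, (if F j then x ^ j else 0) ≤ x ^ (m + 1) / (x ^ 2 - 1)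
  | 0, _ => by
    have : 0 < x ^ 2 - 1 := by nlinarith
    simp only [Finset.range_zero, Finset.sum_empty]
    positivity
  | 1, _ => by
    have : 0 < x ^ 2 - 1 := by nlinarith
    simp only [Finset.sum_range_one, pow_zero]
    rw [le_div_iff₀ this, one_add_one_eq_two]
    split_ifs <;> nlinarith
  | m + 2, h => by
    have h0 : 0 < x ^ 2 - 1 := by nlinarith
    rw [Finset.sum_range_succ]
    -- The bound is the full geometric series `x ^ (m - 1) + x ^ (m - 3) + ...` for range length
    -- `m`. Taking the top exponent forbids the next one, which drops the length by two.
    by_cases hF : F (m + 1)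
    · have hF' : ¬ F m := fun h' => h m (by omega) h' hF
      have ih := sum_pow_of_not_adjacent hx F m fun j hj => h j (by omega)
      rw [Finset.sum_range_succ, if_pos hF, if_neg hF', add_zero]
      have : x ^ (m + 2 + 1) / (x ^ 2 - 1) = x ^ (m + 1) / (x ^ 2 - 1) + x ^ (m + 1) := by
        field_simp
        ring
      linarith
    · have ih := sum_pow_of_not_adjacent hx F (m + 1) fun j hj => h j (by omega)
      rw [if_neg hF, add_zero]
      refine ih.trans (div_le_div_of_nonneg_right ?_ h0.le)
      exact pow_le_pow_right₀ (by linarith) (by omega)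

theorem sum_pow_sub_le {x : ℝ} (hx : 2 ≤ x) (k r : ℕ) :
    ∑ j ∈ Finset.Ico k (k + r), x ^ (k + r - (j + 1)) ≤ x ^ r / (x - 1) := by
  have h0 : 0 < x - 1 := by linarith
  rw [Finset.sum_Ico_eq_sum_range, Nat.add_sub_cancel_left]
  have : ∑ j ∈ Finset.range r, x ^ (k + r - (k + j + 1)) = ∑ j ∈ Finset.range r, x ^ j := by
    rw [← Finset.sum_range_reflect]
    refine Finset.sum_congr rfl fun j hj => ?_
    rw [Finset.mem_range] at hj
    congr 1
    omega
  rw [this, geom_sum_eq (by linarith)]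
  exact div_le_div_of_nonneg_right (by linarith) h0.le

/-- Telescoping: `x ^ a ≤ x ^ (a + 1) - x ^ a` for `x ≥ 2`. Hence exploring the children from the
second on costs no more than a single call with `m - 1` jobs. -/
theorem sum_pow_explore_le {x : ℝ} (hx : 2 ≤ x) (m : ℕ) : ∀ r : ℕ, r + 1 ≤ m →
    ∑ i ∈ Finset.range r, x ^ (m - (2 + i)) ≤ x ^ (m - 1) - x ^ (m - 1 - r)
  | 0, _ => by simp
  | r + 1, h => by
    have ih := sum_pow_explore_le hx m r (by omega)
    rw [Finset.sum_range_succ]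
    have h1 : x ^ (m - 1 - r) = x * x ^ (m - (2 + r)) := by
      rw [← pow_succ']
      congr 1
      omega
    have h2 : m - 1 - (r + 1) = m - (2 + r) := by omega
    have h3 : 0 ≤ x ^ (m - (2 + r)) := by positivity
    rw [h2]
    nlinarith

/-- The base `x` is large enough for the recurrence of TTBM-L with parameter `k`. -/
structure IsGrowthRate (k : ℕ) (x : ℝ) : Prop where
  two_le : 2 ≤ x
  le_one : x⁻¹ + x / (x ^ 2 - 1) + (x ^ k * (x - 1))⁻¹ ≤ 1

/-- This is `le_one` multiplied by `x ^ m`; the terms stand for the first child, the jobs before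
`ℓ`, and the jobs after `ℓ`. -/
theorem IsGrowthRate.pow_le {k m : ℕ} {x : ℝ} (h : IsGrowthRate k x) (hk : 1 ≤ k) (hm : k ≤ m) :
    x ^ (m - 1) + x ^ (m + 1) / (x ^ 2 - 1) + x ^ (m - k) / (x - 1) ≤ x ^ m := by
  have hx := h.two_le
  have h0 : 0 < x ^ 2 - 1 := by nlinarith
  have h1 : 0 < x - 1 := by linarith
  have h2 : 0 < x := by linarith
  have := mul_le_mul_of_nonneg_left h.le_one (show 0 ≤ x ^ m by positivity)
  rw [mul_one] at this
  refine le_trans (le_of_eq ?_) this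
  have e1 : x ^ m = x ^ (m - 1) * x := by
    rw [← pow_succ]
    congr 1
    omega
  have e2 : x ^ m = x ^ (m - k) * x ^ k := by
    rw [← pow_add]
    congr 1
    omega
  rw [mul_add, mul_add]
  congr 1
  · congr 1
    · rw [e1]
      field_simp
    · rw [pow_succ]
      ring
  · rw [e2]
    field_simp

/-- The sizes of all subproblems of a node with `m ≥ k` jobs. -/
theorem IsGrowthRate.sum_le {k m : ℕ} {x : ℝ} (h : IsGrowthRate k x) (hk : 1 ≤ k) (hm : k ≤ m)
    (E : ℕ → Prop) [DecidablePred E] (hE : ∀ i, i < m → E i → ¬ E (i + 1)) :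
    x ^ (m - 1) + ∑ i ∈ Finset.Ico (k + 1) (k + 1 + (m - k)),
      (if E i then x ^ (i - 1) + x ^ (m - i) else 0) ≤ x ^ m := by
  have hx := h.two_le
  have h1 : ∑ i ∈ Finset.Ico (k + 1) (k + 1 + (m - k)),
      (if E i then x ^ (i - 1) + x ^ (m - i) else 0) ≤
      ∑ j ∈ Finset.Ico k m, (if E (j + 1) then x ^ j else 0) +
      ∑ j ∈ Finset.Ico k m, x ^ (m - (j + 1)) := by
    -- With `i = j + 1`, elimination is used only for the parts before `ℓ`; the parts after `ℓ` are
    -- summed over all positions, which costs a term that vanishes as `k` grows.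
    rw [show k + 1 + (m - k) = m + 1 by omega, ← Finset.sum_Ico_add' _ k m 1,
      ← Finset.sum_add_distrib]
    refine Finset.sum_le_sum fun j _ => ?_
    have : 0 ≤ x ^ (m - (j + 1)) := by positivity
    split_ifs
    · simp
    · simpa using this
  have h2 : ∑ j ∈ Finset.Ico k m, (if E (j + 1) then x ^ j else 0) ≤
      ∑ j ∈ Finset.range m, (if E (j + 1) then x ^ j else 0) := by
    refine Finset.sum_le_sum_of_subset_of_nonneg ?_ fun j _ _ => ?_
    · intro j
      simp
    · split_ifs <;> positivity
  have h3 := sum_pow_of_not_adjacent hx (fun j => E (j + 1)) m fun j hj => hE (j + 1) hj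
  have h4 := sum_pow_sub_le hx k (m - k)
  rw [Nat.add_sub_cancel' hm] at h4
  have h5 := h.pow_le hk hm
  linarith

/-- The number 2.247 lies slightly above the root of `1/x + x/(x^2 - 1) = 1`. The resulting slack
already absorbs the term in `k` at `k = 20`. -/
theorem isGrowthRate_of_twenty_le {k : ℕ} (hk : 20 ≤ k) : IsGrowthRate k 2.247 := by
  refine ⟨by norm_num, ?_⟩
  have h1 : ((2.247 : ℝ) ^ k * (2.247 - 1))⁻¹ ≤ (2.247 ^ 20 * (2.247 - 1))⁻¹ := by
    gcongr
    norm_num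
  have h2 : (2.247 : ℝ)⁻¹ + 2.247 / (2.247 ^ 2 - 1) + (2.247 ^ 20 * (2.247 - 1))⁻¹ ≤ 1 := by
    norm_num
  linarith

theorem isGrowthRate_of_two_le {k : ℕ} (hk : 2 ≤ k) : IsGrowthRate k 3.247 := by
  refine ⟨by norm_num, ?_⟩
  have h1 : ((3.247 : ℝ) ^ k * (3.247 - 1))⁻¹ ≤ (3.247 ^ 2 * (3.247 - 1))⁻¹ := by
    gcongr
    norm_num
  have h2 : (3.247 : ℝ)⁻¹ + 3.247 / (3.247 ^ 2 - 1) + (3.247 ^ 2 * (3.247 - 1))⁻¹ ≤ 1 := by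
    norm_num
  linarith

/-! ### Correctness and cost of TTBM-L -/

/-- Bound on the cost of a node of TTBM-L without its recursive calls. -/
def nodeCost (n k : ℕ) : ℕ :=
  n * (27 * n + 19) + k * (2 * childCost n k + ttbr1Cost k k + 30 * n + 30) + 30 * n +
    ttbr1Cost k k + 30

/-- `σ` is at least as good as every completion of the node `(π, S)` and of the nodes of `L`. -/
structure NodeSolution (I : Data n) (t : ℕ) (π S : List (Fin n)) (L : List (Option (List (Fin n))))
    (σ : List (Fin n)) : Prop where
  perm : σ.Perm (π ++ S)
  le : ∀ τ : List (Fin n), τ.Perm S → I.tardiness t σ ≤ I.tardiness t (π ++ τ)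
  le_list : ∀ (i : ℕ) (ρ : List (Fin n)), L[i]? = some (some ρ) → ∀ τ : List (Fin n),
    τ.Perm (S.drop (i + 1)) → I.tardiness t σ ≤ I.tardiness t (ρ ++ τ)

theorem append_drop_perm {π S σ : List (Fin n)} {i : ℕ} (h : σ.Perm (π ++ S.take i)) :
    (σ ++ S.drop i).Perm (π ++ S) := by
  have := h.append_right (S.drop i)
  rwa [List.append_assoc, List.take_append_drop] at this

/-- The nodes of `L` have to be completed too: they may represent siblings of an ancestor that were
merged away and are explored nowhere else. -/
theorem ttbmlNode_small_spec (I : Data n) {k t P : ℕ} {π S : List (Fin n)}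
    {L : List (Option (List (Fin n)))} (hS : I.Edd S)
    (hn : S.Nodup) (hlen : π.length + S.length ≤ n) (hk : S.length < k)
    (hL : IsChildList I k t π S L) :
    Spec (do
      let seqOpt ← completeSmall I k t π S
      explore I t (completeSmall I k t) S 1 L seqOpt) (NodeSolution I t π S L)
      (4 * n + 4 + ttbr1Cost k k + k * (17 * n + 10 + ttbr1Cost k k)) 0 P := by
  have hL1 : L.length ≤ k := by
    rcases hL with rfl | ⟨h, -⟩
    · simp
    · omega
  have hL2 : ∀ (i : ℕ) (ρ : List (Fin n)), L[i]? = some (some ρ) → ρ.Perm (π ++ S.take (i + 1)) := by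
    intro i ρ hi
    rcases hL with rfl | ⟨-, h⟩
    · simp at hi
    · exact (h i _ hi).perm ρ rfl
  have hJ : (π ++ S).length ≤ n := by simpa using hlen
  refine ((completeSmall_spec I hS hn hlen hk.le).bind fun σ hσ =>
    (explore_spec I (N := n) (J := π ++ S) (by omega) hJ
      (fun j ρ σ => ∀ τ, τ.Perm (S.drop j) → I.tardiness t σ ≤ I.tardiness t (ρ ++ τ))
      (fun _ => 0) (fun _ => le_rfl) (W := 1 + (4 * n + 3 + ttbr1Cost k k) + n) 1 L σ hσ.1
      fun i ρ hi => ?_).post ?_).weaken ?_ (by simp)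
  · have hp := append_drop_perm (hL2 i ρ hi)
    rw [Nat.add_comm 1 i]
    have := completeSmall_spec I (k := k) (t := t) (P := P) (π := ρ) (S := S.drop (i + 1))
      (hS.sublist (List.drop_sublist _ _)) (hn.sublist (List.drop_sublist _ _))
      (by rw [← List.length_append, hp.length_eq]; exact hJ) (by simp; omega)
    refine (this.post fun x hx => ⟨hx.1.trans hp, hx.2⟩).call_aux fun x hx => ?_
    rw [hx.1.length_eq]
    exact hJ
  · rintro r ⟨h1, h2, h3⟩
    refine ⟨h1, fun τ hτ => h2.trans (hσ.2 τ hτ), fun i ρ hi τ hτ => ?_⟩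
    obtain ⟨σ', h4, h5⟩ := h3 i ρ hi
    rw [Nat.add_comm 1 i] at h4
    exact h5.trans (h4 τ hτ)
  · have := Nat.mul_le_mul_right (12 * n + 6 + (1 + (4 * n + 3 + ttbr1Cost k k) + n)) hL1
    rw [show 12 * n + 6 + (1 + (4 * n + 3 + ttbr1Cost k k) + n) =
      17 * n + 10 + ttbr1Cost k k by omega] at this ⊢
    omega

/-- The first children of a node, explored recursively after left merging. The hypothesis `hcall`
describes the recursive calls. -/
theorem ttbmlNode_children_spec (I : Data n) {k depth t W P : ℕ} {x Y : ℝ} (hx : 2 ≤ x)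
    (hY : 0 ≤ Y) {π S : List (Fin n)} (hk : 2 ≤ k) (hS : I.Edd S) (hn : S.Nodup)
    (hlen : π.length + S.length ≤ n) (hkS : k ≤ S.length)
    (hcall : ∀ t π' S' L', I.Edd S' → S'.Nodup → π'.length + S'.length ≤ n →
      S'.length < S.length → IsChildList I k t π' S' L' →
      Spec (call (ttbmlNode I k depth t π' S' L')) (NodeSolution I t π' S' L') W
        (Y * x ^ S'.length) P)
    {C : List (Option (List (Fin n)))} (hC : C.length = k)
    (hC' : ∀ i c, C[i]? = some c → Branches I t π S (i + 1) c) :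
    Spec (match C with
        | some π₁ :: others => do
          let (_, S₁) ← split 1 S
          let L₁ ← leftMerge I k t π₁ S₁ others
          let seqCurrent ← call (ttbmlNode I k depth t π₁ S₁ L₁)
          best I t (π ++ S) seqCurrent
        | others =>
          explore I t (fun π' S' => ttbmlNode I k depth t π' S' []) S 1 others (π ++ S))
      (fun σ => σ.Perm (π ++ S) ∧ ∀ (i : ℕ) ρ, C[i]? = some (some ρ) → ∀ τ : List (Fin n),
        τ.Perm (S.drop (i + 1)) → I.tardiness t σ ≤ I.tardiness t (ρ ++ τ))
      (k * (childCost n k + 2) + k * (22 * n + 12 + W) + 12 * n + W + 8)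
      (Y * x ^ (S.length - 1)) P := by
  have hJ : (π ++ S).length ≤ n := by simpa using hlen
  have hd : ∀ i, I.Edd (S.drop i) ∧ (S.drop i).Nodup := fun i =>
    ⟨hS.sublist (List.drop_sublist _ _), hn.sublist (List.drop_sublist _ _)⟩
  have hCp : ∀ (i : ℕ) (ρ : List (Fin n)), C[i]? = some (some ρ) → ρ.Perm (π ++ S.take (i + 1)) :=
    fun i ρ hi => (hC' i _ hi).perm ρ rfl
  have hl : ∀ (i : ℕ) (ρ : List (Fin n)), C[i]? = some (some ρ) →
      ρ.length + (S.drop (i + 1)).length ≤ n := by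
    intro i ρ hi
    rw [← List.length_append, (append_drop_perm (hCp i ρ hi)).length_eq]
    exact hJ
  rcases C with _ | ⟨_ | π₁, others⟩
  · simp at hC
    omega
  · simp only [List.length_cons] at hC
    have hexp := explore_spec I (t := t) (P := P) (W := W) (N := n) (S := S) (J := π ++ S)
      (solve := fun π' S' => ttbmlNode I k depth t π' S' []) (by omega) hJ
      (fun j ρ σ => ∀ τ, τ.Perm (S.drop j) → I.tardiness t σ ≤ I.tardiness t (ρ ++ τ))
      (fun j => Y * x ^ (S.length - j)) (fun _ => by positivity) 2 others (π ++ S) (.refl _) ?_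
    -- The first child is missing: one unit pays for passing it, and the remaining children are
    -- numbered from 2.
    · refine ((Spec.ret (a := 1 + 1)).bind fun j' hj' => ?_).weaken
        (W := 1 + (others.length * (12 * n + 6 + W) + 1))
        (X := 0 + ∑ i ∈ Finset.range others.length, Y * x ^ (S.length - (2 + i))) ?_ ?_
      · subst hj'
        refine hexp.post ?_
        rintro r ⟨h1, h2, h3⟩
        refine ⟨h1, ?_⟩
        rintro (_ | i) ρ hi τ hτ
        · simp at hi
        · obtain ⟨σ', h4, h5⟩ := h3 i ρ (by simpa using hi)
          rw [show 2 + i = i + 1 + 1 by omega] at h4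
          exact h5.trans (h4 τ hτ)
      · have := Nat.mul_le_mul (show others.length ≤ k by omega)
          (show 12 * n + 6 + W ≤ 22 * n + 12 + W by omega)
        omega
      · rw [zero_add, ← Finset.mul_sum]
        refine mul_le_mul_of_nonneg_left ?_ hY
        have := sum_pow_explore_le hx S.length others.length (by omega)
        have : 0 ≤ x ^ (S.length - 1 - others.length) := by positivity
        linarith
    · intro i ρ hi
      have hi' : (none :: others)[i + 1]? = some (some ρ) := by simpa using hi
      rw [show 2 + i = i + 1 + 1 by omega]
      have := hcall t ρ (S.drop (i + 1 + 1)) [] (hd _).1 (hd _).2 (hl (i + 1) ρ hi')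
        (by simp; omega) (.inl rfl)
      rw [List.length_drop] at this
      exact this.post fun σ hσ => ⟨hσ.perm.trans (append_drop_perm (hCp (i + 1) ρ hi')), hσ.le⟩
  · simp only [List.length_cons] at hC
    have h0 : ((some π₁ :: others)[0]? : Option (Option (List (Fin n)))) = some (some π₁) := rfl
    have hπ₁ := hCp 0 π₁ h0
    refine ((split_spec (N := n) 1 S (by omega)).bind fun sp hsp => ?_).weaken
      (W := (2 * n + 1) + ((k * (childCost n k + 2) + k * (10 * n + 6) + 3) +
        (W + (10 * n + 4))))
      (X := 0 + (0 + (Y * x ^ (S.length - 1) + 0))) ?_ (by simp)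
    · subst hsp
      refine (leftMerge_spec I (k := k) (t := t) hS hn hlen hπ₁ (others := others) (by omega)
        fun i σ hi => hCp (i + 1) σ (by simpa using hi)).bind fun L₁ hL₁ => ?_
      have hrec := hcall t π₁ (S.drop 1) L₁ (hd 1).1 (hd 1).2 (hl 0 π₁ h0) (by simp; omega) hL₁.1
      rw [List.length_drop] at hrec
      refine hrec.bind fun σ hσ => ?_
      have hσp : σ.Perm (π ++ S) := hσ.perm.trans (append_drop_perm hπ₁)
      refine (best_spec I (N := n) hJ (by rwa [hσp.length_eq])).post ?_
      rintro r ⟨hr, -, hr'⟩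
      refine ⟨by rcases hr with rfl | rfl <;> [exact .refl _; exact hσp], ?_⟩
      rintro (_ | i) ρ hi τ hτ
      · simp at hi
        subst hi
        exact hr'.trans (hσ.le τ hτ)
      -- A sibling is not explored itself. Its merged representative fixes the same jobs at no
      -- greater cost, so the tail `τ` starts at the same time after both.
      · obtain ⟨ρ', h1, h2, h3⟩ := hL₁.2 i ρ (by simpa using hi)
        have h4 := hσ.le_list i ρ' h1 τ (by
          rw [List.drop_drop]
          rwa [Nat.add_comm 1])
        refine hr'.trans (h4.trans ?_)
        simp only [Data.tardiness_append, Data.load_perm h2]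
        omega
    · have := Nat.mul_le_mul_left k (show 10 * n + 6 ≤ 22 * n + 12 + W by omega)
      omega

/-- The step of TTBM-L at a node `(π, S)` for position `i` of the longest job `ℓ = [κ]`;
`π` starts at `t` and completes at `tEnd`. -/
def branchAt (I : Data n) (k depth t tEnd κ : ℕ) (π S : List (Fin n)) (ℓ : Fin n) (i : ℕ)
    (seqOpt : List (Fin n)) : Comp (List (Fin n)) := do
  let eligible ← le κ i
  if eligible then do
    let (front, A) ← split i S
    let c ← endTime I tEnd front
    let e ← eliminated I κ c front A
    if e then step seqOpt else do
      let B ← remove ℓ front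
      let left ← call (ttbmlNode I k depth tEnd [] B [])
      let right ← call (ttbmlNode I k depth c [] A [])
      let tail ← cons ℓ right
      let mid ← append left tail
      let seqCurrent ← append π mid
      best I t seqOpt seqCurrent
  else step seqOpt

open Classical in
/-- Branching on the positions behind the first `k` ones. -/
theorem ttbmlNode_loop_spec (I : Data n) {k depth t W P κ : ℕ} {x Y : ℝ}
    {π S σ : List (Fin n)} {ℓ : Fin n} (hlong : I.IsLongest S ℓ κ)
    (hS : I.Edd S) (hn : S.Nodup) (hlen : π.length + S.length ≤ n) (hkS : k ≤ S.length)
    (hcall : ∀ t S', I.Edd S' → S'.Nodup → S'.length < S.length →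
      Spec (call (ttbmlNode I k depth t [] S' [])) (I.Solves t S') W (Y * x ^ S'.length) P)
    (hσ : σ.Perm (π ++ S)) :
    Spec (forLoop (branchAt I k depth t (t + I.load π) κ π S ℓ) (k + 1) (S.length - k) σ)
      (fun ρ => ρ.Perm (π ++ S) ∧ I.tardiness t ρ ≤ I.tardiness t σ ∧ ∀ i, k < i →
        i ≤ S.length → κ ≤ i → ¬ I.Eliminated (t + I.load π) S κ i → ∀ β α : List (Fin n),
        β.Perm ((S.take i).erase ℓ) → α.Perm (S.drop i) →
        I.tardiness t ρ ≤ I.tardiness t (π ++ (β ++ ℓ :: α)))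
      (n * (25 * n + 17 + 2 * W) + 1)
      (Y * ∑ i ∈ Finset.Ico (k + 1) (k + 1 + (S.length - k)),
        if κ ≤ i ∧ ¬ I.Eliminated (t + I.load π) S κ i then
          x ^ (i - 1) + x ^ (S.length - i) else 0) P := by
  have hJ : (π ++ S).length ≤ n := by simpa using hlen
  rw [Finset.mul_sum]
  refine (forLoop_spec (P := P) (W := 25 * n + 16 + 2 * W)
    (Inv := fun i ρ => ρ.Perm (π ++ S) ∧ I.tardiness t ρ ≤ I.tardiness t σ ∧ ∀ i', k < i' →
        i' < i → κ ≤ i' → ¬ I.Eliminated (t + I.load π) S κ i' → ∀ β α : List (Fin n),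
        β.Perm ((S.take i').erase ℓ) → α.Perm (S.drop i') →
        I.tardiness t ρ ≤ I.tardiness t (π ++ (β ++ ℓ :: α)))
    (S.length - k) (k + 1) σ ⟨hσ, le_rfl, fun i h1 h2 => by omega⟩ ?_).mono ?_ ?_ le_rfl le_rfl
  · rintro i ρ hi hi' ⟨hρ, hρσ, hρ'⟩
    have hskip : ¬ (κ ≤ i ∧ ¬ I.Eliminated (t + I.load π) S κ i) →
        ρ.Perm (π ++ S) ∧ I.tardiness t ρ ≤ I.tardiness t σ ∧ ∀ i', k < i' →
        i' < i + 1 → κ ≤ i' → ¬ I.Eliminated (t + I.load π) S κ i' → ∀ β α : List (Fin n),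
        β.Perm ((S.take i').erase ℓ) → α.Perm (S.drop i') →
        I.tardiness t ρ ≤ I.tardiness t (π ++ (β ++ ℓ :: α)) := by
      refine fun h => ⟨hρ, hρσ, fun i' h1 h2 h3 h4 => ?_⟩
      rcases Nat.lt_succ_iff_lt_or_eq.1 h2 with h2 | rfl
      · exact hρ' i' h1 h2 h3 h4
      · exact absurd ⟨h3, h4⟩ h
    refine ((Spec.ret (a := decide (κ ≤ i))).bind fun b hb => ?_).weaken
      (W := 1 + (25 * n + 15 + 2 * W)) (X := 0 + _) (by omega) (by rw [zero_add])
    subst hb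
    by_cases hκ : κ ≤ i
    swap
    · simp only [hκ, decide_false, Bool.false_eq_true, if_false, false_and, mul_zero]
      exact Spec.step_le (hskip (by simp [hκ])) (by omega)
    simp only [hκ, decide_true, if_true, true_and]
    refine ((split_spec (N := n) i S (by omega)).bind fun sp hsp => ?_).weaken
      (W := (2 * n + 1) + (23 * n + 14 + 2 * W)) (X := 0 + _) (by omega) (by rw [zero_add])
    subst hsp
    simp only
    have hft : (S.take i).length ≤ n := by simp; omega
    refine ((endTime_spec I (N := n) (t + I.load π) (S.take i) hft).bind fun c hc => ?_).weaken
      (W := (2 * n + 1) + (21 * n + 13 + 2 * W)) (X := 0 + _) (by omega) (by rw [zero_add])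
    subst hc
    refine ((eliminated_spec I (N := n) κ _ (S.take i) (S.drop i) hft).bind fun e he => ?_).weaken
      (W := (7 * n + 5) + (14 * n + 8 + 2 * W)) (X := 0 + _) (by omega) (by rw [zero_add])
    change e = true ↔ I.Eliminated (t + I.load π) S κ i at he
    cases e
    swap
    · have he' : I.Eliminated (t + I.load π) S κ i := he.1 rfl
      simp only [if_true, he', not_true_eq_false, if_false, mul_zero]
      exact Spec.step_le (hskip (by simp [he'])) (by omega)
    have he' : ¬ I.Eliminated (t + I.load π) S κ i := by simpa using he
    simp only [Bool.false_eq_true, if_false, he', not_false_eq_true, if_true]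
    refine ((remove_spec ℓ (S.take i) (N := n) hft).bind fun B hB => ?_).weaken
      (W := (2 * n + 1) + (12 * n + 7 + 2 * W)) (X := 0 + _) (by omega) (by rw [zero_add])
    subst hB
    have hsub : ((S.take i).erase ℓ).Sublist S :=
      List.erase_sublist.trans (List.take_sublist _ _)
    have hBl := hlong.length_erase hκ (by omega)
    have h1 := hcall (t + I.load π) ((S.take i).erase ℓ) (hS.sublist hsub) (hn.sublist hsub)
      (by omega)
    have h2 := hcall (t + I.load π + I.load (S.take i)) (S.drop i)
      (hS.sublist (List.drop_sublist _ _)) (hn.sublist (List.drop_sublist _ _)) (by simp; omega)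
    rw [hBl] at h1
    rw [List.length_drop] at h2
    refine (h1.bind fun left hleft => h2.bind fun right hright => Spec.ret.bind fun tail htail =>
      (append_spec left tail (N := n) ?_).bind fun mid hmid =>
      (append_spec π mid (N := n) (by omega)).bind fun ρ' hρ'' =>
      (best_spec I (N := n) ?_ ?_).post ?_).weaken (by omega) (by rw [mul_add]; simp)
    · rw [hleft.1.length_eq]
      omega
    · rwa [hρ.length_eq]
    all_goals
      subst htail hmid hρ''
      have hp := (hlong.perm_append hκ hleft.1 hright.1).append_left π
    · rwa [hp.length_eq]
    · rintro r ⟨hr, hr1, hr2⟩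
      refine ⟨by rcases hr with rfl | rfl <;> assumption, hr1.trans hρσ,
        fun i' h1 h2 h3 h4 β α hβ hα => ?_⟩
      rcases Nat.lt_succ_iff_lt_or_eq.1 h2 with h2 | rfl
      · exact hr1.trans (hρ' i' h1 h2 h3 h4 β α hβ hα)
      · have := hlong.tardiness_combine_le hκ hleft hright hβ hα
        refine hr2.trans ?_
        rw [Data.tardiness_append, Data.tardiness_append _ _ π]
        omega
  · rintro ρ ⟨h1, h2, h3⟩
    exact ⟨h1, h2, fun i hi hi' => h3 i hi (by omega)⟩
  · have : (S.length - k) * (25 * n + 16 + 2 * W + 1) ≤ n * (25 * n + 17 + 2 * W) :=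
      Nat.mul_le_mul (by omega) (by omega)
    omega

/-- Induction on the depth with potential `nodeCost n k * m * x ^ m` for the calls. The factor `m`
absorbs the own work of the callees, and the power satisfies the recurrence by
`IsGrowthRate.sum_le`. -/
theorem ttbmlNode_spec (I : Data n) {k : ℕ} (hk : 2 ≤ k) {x : ℝ} (hx : IsGrowthRate k x) :
    ∀ (depth t : ℕ) (π S : List (Fin n)) (L : List (Option (List (Fin n)))),
    I.Edd S → S.Nodup → π.length + S.length ≤ n → S.length < depth → IsChildList I k t π S L →
    Spec (ttbmlNode I k depth t π S L) (NodeSolution I t π S L) (nodeCost n k)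
      (nodeCost n k * S.length * x ^ S.length) (nodeCost n k * S.length)
  | 0, _, _, _, _, _, _, _, h, _ => absurd h (by omega)
  | depth + 1, t, π, S, L, hS, hn, hlen, hdepth, hL => by
    have hx2 := hx.two_le
    have hJ : (π ++ S).length ≤ n := by simpa using hlen
    have hcall : ∀ t π' S' L', I.Edd S' → S'.Nodup → π'.length + S'.length ≤ n →
        S'.length < S.length → IsChildList I k t π' S' L' →
        Spec (call (ttbmlNode I k depth t π' S' L')) (NodeSolution I t π' S' L') (1 + n)
          (nodeCost n k * S.length * x ^ S'.length) (nodeCost n k * S.length) := by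
      intro t π' S' L' h1 h2 h3 h4 h5
      refine ((ttbmlNode_spec I hk hx depth t π' S' L' h1 h2 h3 (by omega) h5).call (N := n)
        fun l hl => ?_).mono (fun _ h => h) le_rfl ?_ ?_
      · rw [hl.perm.length_eq, List.length_append]
        exact h3
      · have e1 : (S'.length : ℝ) + 1 ≤ S.length := by exact_mod_cast h4
        have e2 : (1 : ℝ) ≤ x ^ S'.length := one_le_pow₀ (by linarith)
        have e3 : (0 : ℝ) ≤ nodeCost n k := Nat.cast_nonneg _
        calc (nodeCost n k : ℝ) + nodeCost n k * S'.length * x ^ S'.length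
            ≤ nodeCost n k * x ^ S'.length + nodeCost n k * S'.length * x ^ S'.length := by
              nlinarith
          _ = nodeCost n k * ((S'.length + 1) * x ^ S'.length) := by ring
          _ ≤ nodeCost n k * (S.length * x ^ S'.length) := by gcongr
          _ = _ := by ring
      · calc nodeCost n k + nodeCost n k * S'.length = nodeCost n k * (S'.length + 1) := by ring
          _ ≤ _ := Nat.mul_le_mul_left _ h4
    have hX0 : (0 : ℝ) ≤ nodeCost n k * S.length := by positivity
    -- Out of `nodeCost`, `n + 2` units are reserved for the length scan and the comparison with
    -- `k`; the truncated subtraction is exact because `nodeCost` is at least that large.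
    refine ((length_spec S).bind fun m hm => (Spec.ret (a := decide (m < k))).bind fun b hb =>
      ?_).weaken (W := (S.length + 1) + (1 + (nodeCost n k - n - 2)))
      (X := 0 + (0 + nodeCost n k * S.length * x ^ S.length)) ?_ (by simp)
    swap
    · have : n + 2 ≤ nodeCost n k := by
        simp only [nodeCost]
        omega
      omega
    subst hm hb
    by_cases hsmall : S.length < k
    · simp only [hsmall, decide_true, if_true]
      refine (ttbmlNode_small_spec I hS hn hlen hsmall hL).weaken ?_ (by positivity)
      have := Nat.mul_le_mul_left k (show 17 * n + 10 + ttbr1Cost k k ≤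
        2 * childCost n k + ttbr1Cost k k + 30 * n + 30 by omega)
      simp only [nodeCost]
      omega
    have hkS : k ≤ S.length := by omega
    simp only [hsmall, decide_false, Bool.false_eq_true, if_false]
    refine ((append_spec (N := n) π S (by omega)).bind fun s hs =>
      (firstChildren_spec I hk hS hn hlen hL).bind fun C hC =>
      ?_).weaken (W := (n + 1) + ((k * (childCost n k + 2) + k + 2) +
        ((k * (childCost n k + 2) + k * (22 * n + 12 + (1 + n)) + 12 * n + (1 + n) + 8) +
          ((4 * n + 1) + ((2 * n + 1) + (1 + (1 + (n * (25 * n + 17 + 2 * (1 + n)) + 1))))))))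
      (X := 0 + (0 + nodeCost n k * S.length * x ^ S.length)) ?_ (by simp)
    swap
    · have e : 25 * n + 17 + 2 * (1 + n) = 27 * n + 19 := by omega
      have e' : k * (childCost n k + 2) + k + k * (childCost n k + 2) +
          k * (22 * n + 12 + (1 + n)) ≤
          k * (2 * childCost n k + ttbr1Cost k k + 30 * n + 30) := by
        rw [show k * (childCost n k + 2) + k + k * (childCost n k + 2) +
          k * (22 * n + 12 + (1 + n)) = k * (2 * childCost n k + 23 * n + 18) by ring]
        exact Nat.mul_le_mul_left k (by omega)
      rw [e]
      simp only [nodeCost]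
      omega
    subst hs
    obtain ⟨hC, hC', hCL⟩ := hC
    have hch := ttbmlNode_children_spec I hx2 hX0 hk hS hn hlen hkS hcall hC hC'
    rcases S with _ | ⟨a, l⟩
    · simp at hkS
      omega
    have hlong := longest_isLongest I a l
    have hlc := longest_cost I (P := nodeCost n k * (a :: l).length) (N := n) a l
      (by simp at hlen; omega)
    have hbr := fun i c hi => (hC' i c hi).le a l rfl
    classical
    have hgrow := hx.sum_le (by omega) hkS
      (fun i => (longest I a l).val.2 ≤ i ∧
        ¬ I.Eliminated (t + I.load π) (a :: l) (longest I a l).val.2 i) fun i hi h1 h2 =>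
        (I.eliminated_or_eliminated_succ (t + I.load π) (a :: l) h1.1 hi).elim h1.2 h2.2
    -- The loop over the positions beyond `k`, for an arbitrary sequence that already dominates all
    -- completions of the first `k` children; this makes it independent of how those children were
    -- explored.
    have hrest : ∀ σ : List (Fin n), (σ.Perm (π ++ a :: l) ∧ ∀ (i : ℕ) ρ, C[i]? = some (some ρ) →
        ∀ τ : List (Fin n), τ.Perm ((a :: l).drop (i + 1)) →
          I.tardiness t σ ≤ I.tardiness t (ρ ++ τ)) →
        Spec (do
          let (ℓ, κ) ← longest I a l
          let t' ← endTime I t π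
          let first ← add k 1
          let count ← sub (a :: l).length k
          forLoop (branchAt I k depth t t' κ π (a :: l) ℓ) first count σ)
        (NodeSolution I t π (a :: l) L)
        ((4 * n + 1) + ((2 * n + 1) + (1 + (1 + (n * (25 * n + 17 + 2 * (1 + n)) + 1)))))
        (0 + (0 + (0 + (0 + nodeCost n k * (a :: l).length *
          ∑ i ∈ Finset.Ico (k + 1) (k + 1 + ((a :: l).length - k)),
          if (longest I a l).val.2 ≤ i ∧
            ¬ I.Eliminated (t + I.load π) (a :: l) (longest I a l).val.2 i then
            x ^ (i - 1) + x ^ ((a :: l).length - i) else 0))))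
        (nodeCost n k * (a :: l).length) := by
      intro σ hσ
      refine hlc.bind fun lk hlk => ?_
      subst hlk
      generalize (longest I a l).val = lk at *
      obtain ⟨ℓ, κ⟩ := lk
      simp only at hlong hbr ⊢
      generalize a :: l = S at *
      refine (endTime_spec I (N := n) t π (by omega)).bind fun t' ht' =>
        (Spec.ret (a := k + 1)).bind fun fst hfst => (Spec.ret (a := S.length - k)).bind
        fun cnt hcnt => ?_
      subst ht' hfst hcnt
      refine (ttbmlNode_loop_spec I hlong hS hn hlen hkS (fun t S' h1 h2 h3 => ?_) hσ.1).post ?_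
      · refine (hcall t [] S' [] h1 h2 (by simp; omega) h3 (.inl rfl)).post fun σ h => ?_
        exact ⟨by simpa using h.perm, fun τ hτ => by simpa using h.le τ hτ⟩
      · rintro ρ ⟨h1, h2, h3⟩
        refine ⟨h1, fun τ hτ => ?_, fun i ρ' hi τ hτ => h2.trans (hσ.2 i ρ' (hCL i _ hi) τ hτ)⟩
        obtain ⟨i, β, α, hi, hi', he, hβ, hα, hle⟩ :=
          Data.exists_decomposition hlong hS hn (t + I.load π) hτ
        refine le_trans ?_ (show I.tardiness t (π ++ (β ++ ℓ :: α)) ≤ I.tardiness t (π ++ τ) by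
          rw [Data.tardiness_append, Data.tardiness_append _ _ π]
          omega)
        -- The dominating position is either handled by the loop, or it is at most `k` and then
        -- dominated by a completion of child `i`.
        rcases Nat.lt_or_ge k i with hki | hki
        · exact h3 i hki hi' hi he β α hβ hα
        · have hpos := hlong.pos
          obtain ⟨i, rfl⟩ : ∃ i', i = i' + 1 := ⟨i - 1, by omega⟩
          have hiC : i < C.length := by omega
          have hget := List.getElem?_eq_getElem hiC
          obtain ⟨ρ', hρ', hρ''⟩ := hbr i C[i] hget hi
          have hp := (hC' i C[i] hget).perm ρ' hρ'
          have h4 := hσ.2 i ρ' (by rw [hget]; exact congrArg some hρ') α hα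
          have h5 := hρ'' β hβ
          have h6 : I.load ρ' = I.load (π ++ (β ++ [ℓ])) :=
            Data.load_perm (hp.trans ((hlong.perm_take hi hβ).symm.append_left π))
          refine h2.trans (h4.trans ?_)
          rw [show π ++ (β ++ ℓ :: α) = (π ++ (β ++ [ℓ])) ++ α by simp, Data.tardiness_append,
            Data.tardiness_append _ _ (π ++ (β ++ [ℓ])), h6]
          omega
    have hall := (hch.bind hrest).weaken (X' := nodeCost n k * (a :: l).length *
      x ^ (a :: l).length) le_rfl (by
        simp only [zero_add]
        rw [← mul_add]
        exact mul_le_mul_of_nonneg_left hgrow hX0)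
    rcases C with _ | ⟨_ | π₁, others⟩
    · exact hall
    · exact hall
    -- Here the matched branch is itself a sequence of operations, so the continuation has to be
    -- re-associated before it agrees with the unfolded algorithm.
    · simp only [Comp.bind_assoc] at hall
      exact hall

/-! ### From nodes to the whole algorithm. -/

theorem ttbml_spec (I : Data n) {k : ℕ} (hk : 2 ≤ k) {x : ℝ} (hx : IsGrowthRate k x) :
    Spec (ttbml I k) I.IsOptimal (n * (8 * n + 2) + 1 + nodeCost n k)
      (nodeCost n k * n * x ^ n) (nodeCost n k * n) := by
  have hsort := eddSort_spec I (P := nodeCost n k * n) (N := n) (List.finRange n) (by simp)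
  rw [List.length_finRange] at hsort
  refine (hsort.bind fun S hS => ?_).weaken (X := 0 + nodeCost n k * n * x ^ n) le_rfl (by simp)
  have hlen : S.length = n := by rw [hS.1.length_eq, List.length_finRange]
  have hnd : S.Nodup := hS.1.nodup_iff.2 (List.nodup_finRange n)
  have h := ttbmlNode_spec I hk hx (n + 1) 0 [] S [] hS.2 hnd (by simp [hlen]) (by omega) (.inl rfl)
  rw [hlen] at h
  refine h.post fun σ hσ => ?_
  have hp : σ.Perm S := by simpa using hσ.perm
  refine ⟨⟨hp.nodup_iff.2 hnd, fun j => (hp.trans hS.1).mem_iff.2 (List.mem_finRange j)⟩,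
    fun τ hτ => ?_⟩
  simpa using hσ.le τ ((List.perm_ext_iff_of_nodup hτ.1 hnd).2 fun j =>
    ⟨fun _ => hS.1.mem_iff.2 (List.mem_finRange j), fun _ => hτ.2 j⟩)

/-- A polynomial that bounds the space of TTBM-L and the polynomial factor of its time. -/
noncomputable def ttbmlPolynomial (k : ℕ) : Polynomial ℕ :=
  .X * (8 * .X + 2) + 1 +
    (.X * (27 * .X + 19) + .C k * (2 * (13 * .X + 10 + .C (ttbr1Cost k k)) + .C (ttbr1Cost k k) +
      30 * .X + 30) + 30 * .X + .C (ttbr1Cost k k) + 30) * (.X + 1)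

theorem eval_ttbmlPolynomial (n k : ℕ) :
    (ttbmlPolynomial k).eval n = n * (8 * n + 2) + 1 + nodeCost n k * (n + 1) := by
  simp [ttbmlPolynomial, nodeCost, childCost]

theorem ttbml_bounds (I : Data n) {k : ℕ} (hk : 2 ≤ k) {x : ℝ} (hx : IsGrowthRate k x) :
    ((ttbml I k).time : ℝ) ≤ ((ttbmlPolynomial k).eval n : ℕ) * x ^ n ∧
      (ttbml I k).peak ≤ (ttbmlPolynomial k).eval n := by
  have h := ttbml_spec I hk hx
  rw [eval_ttbmlPolynomial]
  constructor
  · refine h.time.trans ?_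
    have h1 : (1 : ℝ) ≤ x ^ n := one_le_pow₀ (by linarith [hx.two_le])
    have h2 : (0 : ℝ) ≤ n * (8 * n + 2) + 1 + nodeCost n k := by positivity
    push_cast
    nlinarith
  · refine h.peak.trans (le_of_eq ?_)
    ring

end TotalTardiness

theorem mainTheorem9 :
    (∀ k : ℕ, 2 ≤ k → ∀ (n : ℕ) (I : TotalTardiness.Data n),
      I.IsOptimal (TotalTardiness.ttbml I k).val) ∧
    ∃ ε : ℕ → ℝ, (∀ k, 0 ≤ ε k) ∧ Filter.Tendsto ε Filter.atTop (nhds 0) ∧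
      ∀ k : ℕ, 2 ≤ k → ∃ q : Polynomial ℕ, ∀ (n : ℕ) (I : TotalTardiness.Data n),
        ((TotalTardiness.ttbml I k).time : ℝ) ≤ ((q.eval n : ℕ) : ℝ) * (2.247 + ε k) ^ n ∧
        (TotalTardiness.ttbml I k).peak ≤ q.eval n := by
  -- Optimality does not depend on the base, so the crude rate 3.247 serves for all `k ≥ 2`. Since
  -- 2.247 itself suffices from `k = 20` on, `ε` can be eventually zero; for the finitely many
  -- smaller `k` it is 1.
  refine ⟨fun k hk n I => (TotalTardiness.ttbml_spec I hk
    (TotalTardiness.isGrowthRate_of_two_le hk)).val, fun k => if 20 ≤ k then 0 else 1,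
    fun k => by positivity, ?_, fun k hk => ⟨TotalTardiness.ttbmlPolynomial k, fun n I => ?_⟩⟩
  · refine tendsto_const_nhds.congr' ?_
    filter_upwards [Filter.eventually_ge_atTop 20] with k hk
    rw [if_pos hk]
  · refine TotalTardiness.ttbml_bounds I hk ?_
    dsimp only
    split_ifs with h
    · rw [add_zero]
      exact TotalTardiness.isGrowthRate_of_twenty_le h
    · rw [show (2.247 + 1 : ℝ) = 3.247 by norm_num]
      exact TotalTardiness.isGrowthRate_of_two_le hk
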